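/- Let $\alpha=(\sqrt5-1)/2$, let $p_n/q_n$ ($n\ge 0$) be its continued fraction convergents $0/1,1/1,1/2,2/3,3/5,\dots$ (so $q_n=p_{n+1}$ are the Fibonacci numbers), and for a function $g$ on $\mathbb R/\mathbb Z$ put $S_m^g(\beta)=\sum_{k=1}^m g(k\beta)$ and $$ f_n^g(x)=S^g_{[xq_n]}\Big(\frac{p_{n+1}}{q_{n+1}}\Big)-S^g_{[xq_n]}\Big(\frac{p_n}{q_n}\Big),\qquad 0\le x<1. $$ Let $E=\{\, j\alpha-[j\alpha] : j\in\mathbb Z\setminus\{0\}\,\}$ and $c=(1+\alpha^2)\pi/\sqrt5$. (a) For $g(x)=\log(2-2\cos 2\pi x)$ the Birkhoff difference functions $f_n=f_n^g$ converge pointwise on $[0,1)$ along the even and along the odd indices: $f_{2n}(x)\to f_e(x)$ and $f_{2n+1}(x)\to f_o(x)$ for all $x\in[0,1)$. For $x\in[0,1)\setminus E$ the two limits agree, so that $f(x)=\lim_n f_n(x)$ exists. (b) For the same $g$, the sums $S_{q_n}^g(\alpha)=\sum_{k=1}^{q_n}g(k\alpha)$ converge to a positive real number, and $\log(S^g_{q_n}(\alpha))/\log(q_n)$,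 $n\ge2$, is bounded. For the rational rotation numbers, the sums $R_n=\sum_{k=1}^{q_n-1}g(kp_n/q_n)$ are positive for $n\ge 2$, the Riemann sums $R_n/q_n$ converge to $0$, and $\log(R_n)/\log(q_n)$, $n\ge2$, is bounded. (c) For the sawtooth $g(x)=2\pi(x-[x]-\tfrac12)$ one has $f^g_{2n}(x)\to c\,x^2$ and $f^g_{2n-1}(x)\to -c\,x^2$ for all $x\in[0,1)$. (d) For the combination $g(x)=2\log(1-e^{2\pi i x})$ (principal logarithm) of real and imaginary part, the limits of the difference functions exist along even and odd indices for all $x\in[0,1)$: $f^g_{2n}(x)\to f_e(x)+i\,c\,x^2$ and $f^g_{2n+1}(x)\to f_o(x)-i\,c\,x^2$. (e) The function $x\mapsto f(\alpha x)+\alpha^2f(x)$ is monotone (non-decreasing) on $[0,1)\setminus E$. On all of $[0,1)$, the functions $x\mapsto f_o(\alpha x)+\alpha^2f_e(x)$ and $x\mapsto f_e(\alpha x)+\alpha^2f_o(x)$ are monotone (non-decreasing). -/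

import Mathlib

open Filter Topology Set

noncomputable section

namespace GoldenBirkhoff

/-- The golden rotation number `α = (√5 - 1) / 2 = [0; 1, 1, 1, …]`. -/
def α : ℝ := (Real.sqrt 5 - 1) / 2

/-- Numerator of the `n`-th continued fraction convergent of `α`;
the convergents are `0/1, 1/1, 1/2, 2/3, 3/5, …`, starting at `n = 0`. -/
def p (n : ℕ) : ℕ := Nat.fib n

/-- Denominator of the `n`-th continued fraction convergent of `α`. -/
def q (n : ℕ) : ℕ := Nat.fib (n + 1)

/-- The Birkhoff sum `S_m(β) = ∑_{k=1}^m g(k β)` with initial point `0` and rotation number `β`. -/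
def birkhoff {E : Type*} [AddCommMonoid E] (g : ℝ → E) (m : ℕ) (β : ℝ) : E :=
  ∑ k ∈ Finset.Icc 1 m, g (k * β)

/-- The `n`-th difference function
`x ↦ S_{[x q_n]}(p_{n+1}/q_{n+1}) - S_{[x q_n]}(p_n/q_n)`, considered for `0 ≤ x < 1`. -/
def diff {E : Type*} [AddCommGroup E] (g : ℝ → E) (n : ℕ) (x : ℝ) : E :=
  birkhoff g ⌊x * (q n : ℝ)⌋₊ ((p (n + 1) : ℝ) / (q (n + 1) : ℝ))
    - birkhoff g ⌊x * (q n : ℝ)⌋₊ ((p n : ℝ) / (q n : ℝ))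

/-- The real part: `log (2 - 2 cos (2 π x)) = 2 log |1 - e^{2 π i x}|`. -/
def logKernel (x : ℝ) : ℝ := Real.log (2 - 2 * Real.cos (2 * Real.pi * x))

/-- The imaginary part: the sawtooth `2 π (x - [x] - 1/2)`. -/
def sawtooth (x : ℝ) : ℝ := 2 * Real.pi * (Int.fract x - 1 / 2)

/-- The combination of both: `2 log (1 - e^{2 π i x})`, with the principal logarithm. -/
def complexKernel (x : ℝ) : ℂ :=
  2 * Complex.log (1 - Complex.exp (2 * Real.pi * Complex.I * x))

/-- The countable set of the points `{j α}`, `j` a nonzero integer. -/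
def orbitPoints : Set ℝ := {x | ∃ j : ℤ, j ≠ 0 ∧ x = Int.fract (j * α)}

/-- The constant `c = (1 + α²) π / √5`. -/
def c : ℝ := (1 + α ^ 2) * Real.pi / Real.sqrt 5

end GoldenBirkhoff

end

namespace GoldenBirkhoff

/-! ### The golden rotation number and its convergents -/

/-! Everything reduces to perturbing a rational rotation. For 0 < k < q_n the points k p_n/q_n run
through the nonzero points of the grid of mesh 1/q_n. Since p_n² ≡ -(-1)^n modulo q_n (`p_sq`), the
point (-1)^n i/q_n is met at time -i p_n mod q_n (`hit`), so the hitting times, divided by q_n, form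
a rotation orbit themselves and tend to {-iα}. If the rotation number moves from p_n/q_n by (-1)^n d
with d q_n² → t < 1, the i-th grid point moves by about t{-iα} mesh widths and does not reach the
pole.

Expanding g at each grid point leaves a second order remainder, of size 1/i², which passes to the
limit by dominated convergence (`tendsto_sum_gridRem`). The linear part, with weights
cot(πi/q_n)/q_n, converges only conditionally: after pairing i with -i it is summed by parts, using
that hitting times at positive and negative indices have partial sums differing by O(√N)
(`abs_sum_cutHit_sub_le`, `tendsto_linear_part`). The result is `tendsto_birkhoff_perturb`. It is
stated along a filter `l`, to serve all indices or one parity.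

For the difference functions t = α, and the terms counted are those with hitting time at most x q_n.
In the limit this reads {-iα} < x, except at ties {-iα} = x, which are decided by the side of α on
which the convergent lies, hence by parity; this is the role of the exceptional orbit. Monotonicity
comes from concavity of g between its poles, since p_{n+2}/q_{n+2} is the mediant of the two
preceding convergents (`pairSum_le_succ`). The sawtooth is affine where g is concave, so its
differences are explicit.

For the full sums, the product of 1 - ζ^k over the nontrivial roots of unity gives R_n = 2 log q_n,
and the passage to α is one more perturbation, with t = 1/√5. Positivity of the limit follows from
concavity in t and one reflection identity (`limitSum_add_limitSum`, `limit_pos`). -/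

lemma α_sq : α ^ 2 = 1 - α := by
  have h : Real.sqrt 5 ^ 2 = 5 := Real.sq_sqrt (by norm_num)
  unfold α
  linear_combination h / 4

lemma sqrt_five_eq : Real.sqrt 5 = 2 * α + 1 := by
  unfold α; ring

lemma α_pos : 0 < α := by
  have h : (1 : ℝ) < Real.sqrt 5 := by
    rw [Real.lt_sqrt] <;> norm_num
  unfold α; linarith

lemma α_lt_one : α < 1 := by
  nlinarith [α_sq, α_pos]

lemma α_eq_neg_goldenConj : α = -Real.goldenConj := by
  unfold α Real.goldenConj; ring

lemma irrational_α : Irrational α := by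
  rw [α_eq_neg_goldenConj]
  exact Real.goldenConj_irrational.neg

lemma int_mul_α_ne {i : ℤ} (hi : i ≠ 0) (m : ℤ) : (i : ℝ) * α ≠ m :=
  (irrational_α.intCast_mul hi).ne_int m

lemma q_pos (n : ℕ) : 0 < q n := Nat.fib_pos.2 n.succ_pos

lemma q_cast_pos (n : ℕ) : (0 : ℝ) < q n := by exact_mod_cast q_pos n

lemma q_cast_ne (n : ℕ) : (q n : ℝ) ≠ 0 := (q_cast_pos n).ne'

lemma p_succ (n : ℕ) : p (n + 1) = q n := rfl

lemma q_add_two (n : ℕ) : q (n + 2) = q n + q (n + 1) := Nat.fib_add_two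

lemma q_succ (n : ℕ) : q (n + 1) = p n + q n := Nat.fib_add_two

lemma q_mono : Monotone q := fun _ _ h => Nat.fib_mono (Nat.succ_le_succ h)

lemma coprime_p_q (n : ℕ) : (p n).Coprime (q n) := Nat.fib_coprime_fib_succ n

lemma cassini (n : ℕ) : (q n : ℤ) * q n - p n * q (n + 1) = (-1) ^ n := by
  induction n with
  | zero => simp [q, p]
  | succ n ih =>
    rw [p_succ, q_add_two, pow_succ, ← ih]
    have := q_succ n
    zify at this
    push_cast
    rw [this]
    ring

/-- Modulo `q n`, the numerator is its own inverse up to sign. This is why the times at which the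
grid points are met are again given by multiplication by `p n`. -/
lemma p_sq (n : ℕ) : (p n : ℤ) * p n = (q n - p n) * q n - (-1) ^ n := by
  have := q_succ n
  zify at this
  rw [← cassini, this]
  ring

/-- The `n`-th convergent as a real number. -/
noncomputable def conv (n : ℕ) : ℝ := (p n : ℝ) / (q n : ℝ)

lemma q_mul_conv (n : ℕ) : (q n : ℝ) * conv n = p n := by
  unfold conv; field_simp [q_cast_ne n]

lemma q_mul_α (n : ℕ) : (q n : ℝ) * α - p n = (-1) ^ n * α ^ (n + 1) := by
  induction n with
  | zero => simp [q, p]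
  | succ n ih =>
    rw [p_succ, q_succ, pow_succ (-1 : ℝ), pow_succ α]
    push_cast
    linear_combination -α * ih + (q n : ℝ) * α_sq

lemma conv_succ (n : ℕ) : conv (n + 1) = conv n + (-1) ^ n * (1 / (q n * q (n + 1))) := by
  have h := cassini n
  have h' : (q n : ℝ) * q n - p n * q (n + 1) = (-1) ^ n := by exact_mod_cast h
  have h1 := q_cast_ne n
  have h2 := q_cast_ne (n + 1)
  unfold conv
  rw [p_succ, ← h']
  field_simp
  ring

lemma conv_add_two (n : ℕ) : conv (n + 2) = conv n + (-1) ^ n * (1 / (q n * q (n + 2))) := by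
  have h1 := q_cast_ne n
  have h2 := q_cast_ne (n + 1)
  have h3 := q_cast_ne (n + 2)
  rw [conv_succ (n + 1), conv_succ n, pow_succ, add_assoc]
  congr 1
  have : (q (n + 2) : ℝ) = q n + q (n + 1) := by exact_mod_cast q_add_two n
  field_simp
  rw [this]
  ring

lemma α_eq_conv_add (n : ℕ) : α = conv n + (-1) ^ n * (α ^ (n + 1) / q n) := by
  have h1 := q_cast_ne n
  have := q_mul_α n
  unfold conv
  field_simp
  linear_combination this

lemma tendsto_q : Tendsto (fun n => (q n : ℝ)) atTop atTop := by
  have h : Tendsto (fun n : ℕ => ((n : ℕ) : ℝ)) atTop atTop := tendsto_natCast_atTop_atTop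
  refine tendsto_atTop_mono' _ ?_ h
  filter_upwards [eventually_ge_atTop 5] with n hn
  have : n + 1 ≤ Nat.fib (n + 1) := Nat.le_fib_self (by omega)
  unfold q
  exact_mod_cast (Nat.le_succ n).trans this

lemma tendsto_α_pow : Tendsto (fun n => α ^ n) atTop (𝓝 0) :=
  tendsto_pow_atTop_nhds_zero_of_lt_one α_pos.le α_lt_one

lemma tendsto_q_div_q_succ : Tendsto (fun n => (q n : ℝ) / q (n + 1)) atTop (𝓝 α) := by
  have h : ∀ n, (q n : ℝ) / q (n + 1) = α - (-1) ^ (n + 1) * α ^ (n + 2) / q (n + 1) := by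
    intro n
    have h1 := q_cast_ne (n + 1)
    have := q_mul_α (n + 1)
    rw [p_succ] at this
    field_simp
    linear_combination -this
  have h0 : Tendsto (fun n => (-1 : ℝ) ^ (n + 1) * α ^ (n + 2) / q (n + 1)) atTop (𝓝 0) := by
    refine squeeze_zero_norm (a := fun n => α ^ n) (fun n => ?_) tendsto_α_pow
    have h1 : (1 : ℝ) ≤ q (n + 1) := by exact_mod_cast q_pos (n + 1)
    rw [norm_div, norm_mul, norm_pow, norm_neg, norm_one, one_pow, one_mul, Real.norm_of_nonneg
      (pow_nonneg α_pos.le _), Real.norm_of_nonneg (q_cast_pos _).le]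
    refine (div_le_self (pow_nonneg α_pos.le _) h1).trans ?_
    exact pow_le_pow_of_le_one α_pos.le α_lt_one.le (by omega)
  simpa [h] using tendsto_const_nhds.sub h0

lemma tendsto_q_div_q_add_two : Tendsto (fun n => (q n : ℝ) / q (n + 2)) atTop (𝓝 (α ^ 2)) := by
  have h := tendsto_q_div_q_succ.mul (tendsto_q_div_q_succ.comp (tendsto_add_atTop_nat 1))
  rw [sq]
  refine h.congr fun n => ?_
  have h1 := q_cast_ne (n + 1)
  have h2 := q_cast_ne (n + 2)
  simp only [Function.comp]
  field_simp

lemma tendsto_α_pow_mul_q :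
    Tendsto (fun n => α ^ (n + 1) * (q n : ℝ)) atTop (𝓝 (1 / Real.sqrt 5)) := by
  have h5 : Real.sqrt 5 ≠ 0 := by positivity
  have h : ∀ n, α ^ (n + 1) * (q n : ℝ) = (1 - (-(α * α)) ^ (n + 1)) / Real.sqrt 5 := by
    intro n
    have h1 : α * Real.goldenRatio = 1 := by
      rw [α_eq_neg_goldenConj, neg_mul, Real.goldenConj_mul_goldenRatio, neg_neg]
    have h2 : -(α * α) = α * Real.goldenConj := by
      rw [α_eq_neg_goldenConj]; ring
    have h3 : α ^ (n + 1) * Real.goldenRatio ^ (n + 1) = 1 := by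
      rw [← mul_pow, h1, one_pow]
    unfold q
    rw [Real.coe_fib_eq, h2, mul_pow, ← h3]
    ring
  simp only [h]
  have h0 : Tendsto (fun n => (-(α * α)) ^ (n + 1)) atTop (𝓝 0) := by
    refine (tendsto_pow_atTop_nhds_zero_of_abs_lt_one ?_).comp (tendsto_add_atTop_nat 1)
    rw [abs_neg, abs_of_nonneg (mul_self_nonneg _)]
    nlinarith [α_pos, α_lt_one]
  simpa using ((tendsto_const_nhds (x := (1 : ℝ))).sub h0).div_const (Real.sqrt 5)

lemma tendsto_conv : Tendsto conv atTop (𝓝 α) := by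
  refine (tendsto_add_atTop_iff_nat 1).1 (tendsto_q_div_q_succ.congr fun n => ?_)
  rw [conv, p_succ]

/-- The signed distance of the convergents from `α` alternates. -/
lemma neg_one_pow_mul_α_sub_conv_pos (n : ℕ) : 0 < (-1) ^ n * (α - conv n) := by
  have h := α_eq_conv_add n
  have h2 : ((-1 : ℝ) ^ n) * (-1) ^ n = 1 := by
    rw [← mul_pow]; norm_num
  have h3 : (-1) ^ n * (α - conv n) = α ^ (n + 1) / q n := by
    linear_combination (-1) ^ n * h + α ^ (n + 1) / q n * h2
  rw [h3]
  exact div_pos (pow_pos α_pos _) (q_cast_pos n)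

/-! ### Elementary facts on the kernels -/

/-- No sign condition on the sine is needed: `Real.log` is the logarithm of the absolute value, and
both sides vanish at the poles. -/
lemma logKernel_eq (x : ℝ) : logKernel x = 2 * Real.log (2 * Real.sin (Real.pi * x)) := by
  have h : 2 - 2 * Real.cos (2 * Real.pi * x) = (2 * Real.sin (Real.pi * x)) ^ 2 := by
    rw [mul_assoc 2 Real.pi x, Real.cos_two_mul, Real.cos_sq']
    ring
  rw [logKernel, h, Real.log_pow]
  norm_num

lemma logKernel_neg (x : ℝ) : logKernel (-x) = logKernel x := by
  simp [logKernel]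

lemma logKernel_add_int (x : ℝ) (m : ℤ) : logKernel (x + m) = logKernel x := by
  unfold logKernel
  rw [show 2 * Real.pi * (x + m) = 2 * Real.pi * x + m * (2 * Real.pi) by ring,
    Real.cos_add_int_mul_two_pi]

lemma logKernel_neg_one_pow_mul (n : ℕ) (x : ℝ) : logKernel ((-1) ^ n * x) = logKernel x := by
  rcases neg_one_pow_eq_or ℝ n with h | h <;> simp [h, logKernel_neg]

lemma logKernel_eq_log_norm (x : ℝ) :
    logKernel x = 2 * Real.log ‖1 - Complex.exp (2 * Real.pi * Complex.I * x)‖ := by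
  have h : 2 - 2 * Real.cos (2 * Real.pi * x)
      = ‖1 - Complex.exp (2 * Real.pi * Complex.I * x)‖ ^ 2 := by
    rw [← Complex.normSq_eq_norm_sq, Complex.normSq_apply,
      show 2 * (Real.pi : ℂ) * Complex.I * x = ((2 * Real.pi * x : ℝ) : ℂ) * Complex.I by
        push_cast; ring]
    simp only [Complex.sub_re, Complex.sub_im, Complex.one_re, Complex.one_im,
      Complex.exp_ofReal_mul_I_re, Complex.exp_ofReal_mul_I_im]
    nlinarith [Real.sin_sq_add_cos_sq (2 * Real.pi * x)]
  rw [logKernel, h, Real.log_pow]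
  norm_num

lemma sum_Icc_one {M : Type*} [AddCommMonoid M] (f : ℕ → M) (m : ℕ) :
    ∑ k ∈ Finset.Icc 1 m, f k = ∑ j ∈ Finset.range m, f (j + 1) := by
  induction m with
  | zero => simp
  | succ m ih => rw [Finset.sum_Icc_succ_top (by omega), ih, Finset.sum_range_succ]

/-- The full sum over the nonzero multiples of a reduced fraction. -/
lemma birkhoff_logKernel_ratio (a b : ℕ) (hb : 0 < b) (hab : a.Coprime b) :
    birkhoff logKernel (b - 1) ((a : ℝ) / b) = 2 * Real.log b := by
  obtain ⟨m, rfl⟩ : ∃ m, b = m + 1 := ⟨b - 1, by omega⟩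
  have hζ := Complex.isPrimitiveRoot_exp_of_coprime a (m + 1) (by omega) hab
  have hprod := hζ.prod_one_sub_pow_eq_order
  set ζ := Complex.exp (2 * Real.pi * Complex.I * ((a : ℂ) / ((m + 1 : ℕ) : ℂ))) with hζd
  have hterm : ∀ k : ℕ, logKernel (k * ((a : ℝ) / ((m + 1 : ℕ) : ℝ)))
      = 2 * Real.log ‖1 - ζ ^ k‖ := by
    intro k
    rw [logKernel_eq_log_norm, hζd, ← Complex.exp_nat_mul]
    congr 5
    push_cast
    ring
  have hne : ∀ k ∈ Finset.range m, ‖1 - ζ ^ (k + 1)‖ ≠ 0 := by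
    intro k hk
    rw [norm_ne_zero_iff, sub_ne_zero]
    exact (hζ.pow_ne_one_of_pos_of_lt (by omega) (by simp at hk; omega)).symm
  unfold birkhoff
  simp only [hterm, Nat.add_sub_cancel]
  rw [sum_Icc_one, ← Finset.mul_sum, ← Real.log_prod hne, ← norm_prod, hprod]
  norm_cast

/-- With y the fractional part, 1 - e^{2πiy} = 2 sin(πy) e^{iπ(y - 1/2)}, and the angle lies in
(-π/2, π/2), so it is the principal argument. At integers the identity fails: `Complex.log 0 = 0`,
while the sawtooth equals -π. -/
lemma complexKernel_eq (x : ℝ) (hx : Int.fract x ≠ 0) :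
    complexKernel x = (logKernel x : ℂ) + (sawtooth x : ℂ) * Complex.I := by
  have hf0 : 0 < Int.fract x := lt_of_le_of_ne (Int.fract_nonneg x) hx.symm
  have hf1 := Int.fract_lt_one x
  set y := Int.fract x with hy
  have hexp : Complex.exp (2 * Real.pi * Complex.I * x)
      = Complex.exp (((2 * Real.pi * y : ℝ) : ℂ) * Complex.I) := by
    rw [Complex.exp_eq_exp_iff_exists_int]
    refine ⟨⌊x⌋, ?_⟩
    rw [hy, Int.fract]
    push_cast
    ring
  have hpi := Real.pi_pos
  have hs : 0 < Real.sin (Real.pi * y) :=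
    Real.sin_pos_of_pos_of_lt_pi (by positivity) (by nlinarith)
  have hpolar : 1 - Complex.exp (2 * Real.pi * Complex.I * x)
      = ((2 * Real.sin (Real.pi * y) : ℝ) : ℂ)
        * (Complex.cos ((Real.pi * (y - 1 / 2) : ℝ) : ℂ)
          + Complex.sin ((Real.pi * (y - 1 / 2) : ℝ) : ℂ) * Complex.I) := by
    rw [hexp, ← Complex.ofReal_cos, ← Complex.ofReal_sin,
      show Real.pi * (y - 1 / 2) = Real.pi * y - Real.pi / 2 by ring, Real.cos_sub_pi_div_two,
      Real.sin_sub_pi_div_two]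
    apply Complex.ext
    · simp only [Complex.sub_re, Complex.one_re, Complex.exp_ofReal_mul_I_re,
        Complex.re_ofReal_mul, Complex.add_re, Complex.ofReal_re, Complex.mul_I_re,
        Complex.ofReal_im]
      rw [mul_assoc 2 Real.pi y, Real.cos_two_mul, Real.cos_sq']
      ring
    · simp only [Complex.sub_im, Complex.one_im, Complex.exp_ofReal_mul_I_im,
        Complex.im_ofReal_mul, Complex.add_im, Complex.ofReal_re, Complex.mul_I_im,
        Complex.ofReal_im]
      rw [mul_assoc 2 Real.pi y, Real.sin_two_mul]
      ring
  have harg : Complex.arg (1 - Complex.exp (2 * Real.pi * Complex.I * x))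
      = Real.pi * (y - 1 / 2) := by
    rw [hpolar]
    exact Complex.arg_mul_cos_add_sin_mul_I (by positivity) ⟨by nlinarith, by nlinarith⟩
  apply Complex.ext
  · simp [complexKernel, Complex.log_re, logKernel_eq_log_norm]
  · have : (2 * Complex.log (1 - Complex.exp (2 * Real.pi * Complex.I * x))).im
        = 2 * (Real.pi * (y - 1 / 2)) := by
      rw [← harg, ← Complex.log_im]
      simp
    rw [complexKernel, this]
    simp [sawtooth, hy]
    ring

/-! ### Discrepancy of rational rotations -/

/-- Sum of floors along a complete residue system, up to a constant. -/
lemma sum_ediv_residues (P : ℤ) (Q : ℕ) (hQ : 0 < Q) (hPQ : IsCoprime P (Q : ℤ)) (A : ℤ) :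
    ∑ r ∈ Finset.range Q, (A + r * P) / (Q : ℤ)
      = A + ∑ r ∈ Finset.range Q, ((r : ℤ) * P) / (Q : ℤ) := by
  have hQ0 : (Q : ℤ) ≠ 0 := by exact_mod_cast hQ.ne'
  -- As P is invertible modulo Q, the remainders of B + rP are a permutation of 0, …, Q - 1, so
  -- their sum does not depend on B.
  have hmod : ∀ B : ℤ, ∑ r ∈ Finset.range Q, (B + r * P) % (Q : ℤ)
      = ∑ r ∈ Finset.range Q, (r : ℤ) := by
    intro B
    have hmaps : Set.MapsTo (fun r : ℕ => ((B + r * P) % (Q : ℤ)).toNat)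
        (Finset.range Q) (Finset.range Q) := by
      intro r _
      have h1 := Int.emod_nonneg (B + r * P) hQ0
      have h2 := Int.emod_lt_of_pos (B + r * P) (by exact_mod_cast hQ : (0 : ℤ) < Q)
      simp only [Finset.coe_range, Set.mem_Iio]
      omega
    have hinj : Set.InjOn (fun r : ℕ => ((B + r * P) % (Q : ℤ)).toNat) (Finset.range Q) := by
      intro r hr s hs hrs
      have h1 := Int.emod_nonneg (B + r * P) hQ0
      have h2 := Int.emod_nonneg (B + s * P) hQ0
      simp only [Finset.coe_range, Set.mem_Iio] at hr hs hrs
      have h3 : (B + r * P) % (Q : ℤ) = (B + s * P) % (Q : ℤ) := by omega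
      have h4 : (Q : ℤ) ∣ ((s : ℤ) - r) * P := by
        have := Int.ModEq.dvd h3
        convert this using 1; ring
      have h5 : (Q : ℤ) ∣ (s : ℤ) - r := hPQ.symm.dvd_of_dvd_mul_right h4
      have h6 : (s : ℤ) - r = 0 := Int.eq_zero_of_abs_lt_dvd h5 (by rw [abs_lt]; omega)
      omega
    refine Finset.sum_nbij (fun r : ℕ => ((B + r * P) % (Q : ℤ)).toNat) hmaps hinj
      (Finset.surjOn_of_injOn_of_card_le _ hmaps hinj le_rfl) fun r _ => ?_
    exact (Int.toNat_of_nonneg (Int.emod_nonneg _ hQ0)).symm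
  have key : ∀ B : ℤ, (Q : ℤ) * ∑ r ∈ Finset.range Q, (B + r * P) / (Q : ℤ)
      = Q * B + ∑ r ∈ Finset.range Q, (r : ℤ) * P - ∑ r ∈ Finset.range Q, (r : ℤ) := by
    intro B
    have h1 : ∑ r ∈ Finset.range Q, (B + r * P) = Q * B + ∑ r ∈ Finset.range Q, (r : ℤ) * P := by
      simp [Finset.sum_add_distrib]
    rw [← hmod B, ← h1, Finset.mul_sum, ← Finset.sum_sub_distrib]
    refine Finset.sum_congr rfl fun r _ => ?_
    linarith [Int.mul_ediv_add_emod (B + r * P) (Q : ℤ)]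
  have h0 := key 0
  simp only [zero_add, mul_zero] at h0
  apply mul_left_cancel₀ hQ0
  rw [key A, mul_add, h0]
  ring

lemma fract_lt_indicator (z u : ℝ) (hu0 : 0 ≤ u) (hu1 : u ≤ 1) :
    (if Int.fract z < u then (1 : ℝ) else 0) = (⌊z⌋ : ℝ) - ⌊z - u⌋ := by
  have h := Int.fract_add_floor z
  have h0 := Int.fract_nonneg z
  have h1 := Int.fract_lt_one z
  split_ifs with hlt
  · have : ⌊z - u⌋ = ⌊z⌋ - 1 := by
      rw [Int.floor_eq_iff]; push_cast; constructor <;> linarith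
    rw [this]; push_cast; ring
  · have : ⌊z - u⌋ = ⌊z⌋ := by
      rw [Int.floor_eq_iff]; constructor <;> linarith
    rw [this]; ring

/-- A block of length `Q` of a rotation that is `1 / Q ^ 2`-close to a fraction with
denominator `Q` is equidistributed up to a bounded error. -/
lemma count_block (β : ℝ) (P : ℤ) (Q : ℕ) (hQ : 0 < Q) (hPQ : IsCoprime P (Q : ℤ))
    (hβ : |β - P / Q| ≤ 1 / (Q : ℝ) ^ 2) (a u : ℝ) (hu0 : 0 ≤ u) (hu1 : u ≤ 1) :
    |∑ r ∈ Finset.range Q, (if Int.fract (a + r * β) < u then (1 : ℝ) else 0) - Q * u| ≤ 3 := by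
  have hQr : (0 : ℝ) < Q := by exact_mod_cast hQ
  set K : ℤ := ∑ r ∈ Finset.range Q, ((r : ℤ) * P) / (Q : ℤ) with hK
  have hexact : ∀ b : ℝ, ∑ r ∈ Finset.range Q, ⌊b + r * (P / Q : ℝ)⌋ = ⌊Q * b⌋ + K := by
    intro b
    rw [hK, ← sum_ediv_residues P Q hQ hPQ]
    refine Finset.sum_congr rfl fun r _ => ?_
    have h1 : b + r * (P / Q : ℝ) = (Q * b + ((r * P : ℤ) : ℝ)) / (Q : ℕ) := by
      push_cast; field_simp
    rw [h1, Int.floor_div_natCast, Int.floor_add_intCast]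
  have hle : ∀ r ∈ Finset.range Q, |r * (β - P / Q)| ≤ 1 / (Q : ℝ) := by
    intro r hr
    have hr' : (r : ℝ) ≤ Q := by exact_mod_cast (Finset.mem_range.1 hr).le
    rw [abs_mul, abs_of_nonneg (Nat.cast_nonneg r)]
    calc (r : ℝ) * |β - P / Q| ≤ Q * (1 / (Q : ℝ) ^ 2) := by gcongr
      _ = 1 / Q := by field_simp
  -- Within the block β drifts from P/Q by at most 1/Q in total. Moving b by 1/Q absorbs the drift
  -- and changes ⌊Qb⌋ by exactly 1. Two such errors and the rounding of ⌊Qa⌋ - ⌊Q(a - u)⌋ make up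
  -- the constant 3.
  have hupper : ∀ b : ℝ, ∑ r ∈ Finset.range Q, ⌊b + r * β⌋ ≤ ⌊Q * b⌋ + 1 + K := by
    intro b
    have := hexact (b + 1 / Q)
    rw [mul_add, mul_one_div_cancel hQr.ne', Int.floor_add_one] at this
    rw [← this]
    refine Finset.sum_le_sum fun r hr => Int.floor_mono ?_
    have := (abs_le.1 (hle r hr)).2
    linarith
  have hlower : ∀ b : ℝ, ⌊Q * b⌋ - 1 + K ≤ ∑ r ∈ Finset.range Q, ⌊b + r * β⌋ := by
    intro b
    have := hexact (b - 1 / Q)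
    rw [mul_sub, mul_one_div_cancel hQr.ne', Int.floor_sub_one] at this
    rw [← this]
    refine Finset.sum_le_sum fun r hr => Int.floor_mono ?_
    have := (abs_le.1 (hle r hr)).1
    linarith
  have hsum : ∑ r ∈ Finset.range Q, (if Int.fract (a + r * β) < u then (1 : ℝ) else 0)
      = ((∑ r ∈ Finset.range Q, ⌊a + r * β⌋ : ℤ) : ℝ)
        - ((∑ r ∈ Finset.range Q, ⌊(a - u) + r * β⌋ : ℤ) : ℝ) := by
    push_cast
    rw [← Finset.sum_sub_distrib]
    refine Finset.sum_congr rfl fun r _ => ?_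
    rw [fract_lt_indicator _ _ hu0 hu1, show a + r * β - u = a - u + r * β by ring]
  rw [hsum, abs_le]
  have h1 : ((∑ r ∈ Finset.range Q, ⌊a + r * β⌋ : ℤ) : ℝ) ≤ ⌊Q * a⌋ + 1 + K := by
    exact_mod_cast hupper a
  have h2 : (⌊Q * a⌋ - 1 + K : ℝ) ≤ ((∑ r ∈ Finset.range Q, ⌊a + r * β⌋ : ℤ) : ℝ) := by
    exact_mod_cast hlower a
  have h3 : ((∑ r ∈ Finset.range Q, ⌊(a - u) + r * β⌋ : ℤ) : ℝ) ≤ ⌊Q * (a - u)⌋ + 1 + K := by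
    exact_mod_cast hupper (a - u)
  have h4 : (⌊Q * (a - u)⌋ - 1 + K : ℝ)
      ≤ ((∑ r ∈ Finset.range Q, ⌊(a - u) + r * β⌋ : ℤ) : ℝ) := by
    exact_mod_cast hlower (a - u)
  have h5 := Int.floor_le ((Q : ℝ) * a)
  have h6 := Int.lt_floor_add_one ((Q : ℝ) * a)
  have h7 := Int.floor_le ((Q : ℝ) * (a - u))
  have h8 := Int.lt_floor_add_one ((Q : ℝ) * (a - u))
  constructor <;> linarith

/-- Consecutive blocks and an incomplete one. -/
lemma count_blocks (β : ℝ) (P : ℤ) (Q : ℕ) (hQ : 0 < Q) (hPQ : IsCoprime P (Q : ℤ))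
    (hβ : |β - P / Q| ≤ 1 / (Q : ℝ) ^ 2) (u : ℝ) (hu0 : 0 ≤ u) (hu1 : u ≤ 1) (b s : ℕ) (a : ℝ) :
    |∑ r ∈ Finset.range (Q * b + s), (if Int.fract (a + r * β) < u then (1 : ℝ) else 0)
      - (Q * b + s : ℕ) * u| ≤ 3 * b + s := by
  induction b generalizing a with
  | zero =>
    simp only [mul_zero, zero_add, Nat.cast_zero]
    have h1 : ∑ r ∈ Finset.range s, (if Int.fract (a + r * β) < u then (1 : ℝ) else 0) ≤ s := by
      calc _ ≤ ∑ r ∈ Finset.range s, (1 : ℝ) :=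
            Finset.sum_le_sum fun r _ => by split_ifs <;> norm_num
        _ = s := by simp
    have h0 : 0 ≤ ∑ r ∈ Finset.range s, (if Int.fract (a + r * β) < u then (1 : ℝ) else 0) :=
      Finset.sum_nonneg fun r _ => by split_ifs <;> norm_num
    have h2 : (s : ℝ) * u ≤ s := mul_le_of_le_one_right (Nat.cast_nonneg _) hu1
    have h3 : 0 ≤ (s : ℝ) * u := by positivity
    rw [abs_le]; constructor <;> linarith
  | succ b ih =>
    have hblock := count_block β P Q hQ hPQ hβ a u hu0 hu1
    have hih := ih (a + Q * β)
    rw [show Q * (b + 1) + s = Q + (Q * b + s) by ring, Finset.sum_range_add]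
    have hshift : ∀ r ∈ Finset.range (Q * b + s),
        (if Int.fract (a + ((Q + r : ℕ) : ℝ) * β) < u then (1 : ℝ) else 0)
          = if Int.fract (a + Q * β + r * β) < u then (1 : ℝ) else 0 := by
      intro r _
      rw [show a + ((Q + r : ℕ) : ℝ) * β = a + Q * β + r * β by push_cast; ring]
    rw [Finset.sum_congr rfl hshift]
    rw [abs_le] at hblock hih ⊢
    push_cast at hblock hih ⊢
    constructor <;> linarith [hblock.1, hblock.2, hih.1, hih.2]

/-! ### The inverse of the rotation on the grid, and its discrepancy -/

/-- The time at which the rotation by `p n / q n` meets the grid point `(-1) ^ n * i / q n`. -/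
def hit (n : ℕ) (i : ℤ) : ℤ := (-i * p n) % (q n : ℤ)

lemma hit_nonneg (n : ℕ) (i : ℤ) : 0 ≤ hit n i :=
  Int.emod_nonneg _ (by exact_mod_cast (q_pos n).ne')

lemma hit_lt (n : ℕ) (i : ℤ) : hit n i < q n :=
  Int.emod_lt_of_pos _ (by exact_mod_cast q_pos n)

lemma hit_div_q (n : ℕ) (i : ℤ) : (hit n i : ℝ) / q n = Int.fract (-i * conv n) := by
  have h := Int.fract_div_intCast_eq_div_intCast_mod (k := ℝ) (m := -i * p n) (n := q n)
  rw [show -(i : ℝ) * conv n = ((-i * p n : ℤ) : ℝ) / ((q n : ℕ) : ℝ) by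
    unfold conv; push_cast; ring]
  rw [h, hit]

lemma hit_eq (n : ℕ) (i : ℤ) : (hit n i : ℝ) = -i * p n - q n * ⌊-i * conv n⌋ := by
  have h := hit_div_q n i
  rw [div_eq_iff (q_cast_ne n), Int.fract] at h
  rw [h, sub_mul, mul_assoc, mul_comm (conv n), q_mul_conv]
  ring

lemma hit_le_iff (n : ℕ) (i : ℤ) (u : ℕ) :
    hit n i ≤ u ↔ Int.fract (-i * conv n) < ((u : ℝ) + 1) / q n := by
  rw [← hit_div_q, div_lt_div_iff_of_pos_right (q_cast_pos n)]
  rw [← Int.lt_add_one_iff]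
  exact_mod_cast Iff.rfl

lemma conv_sub_conv (j l : ℕ) :
    0 ≤ (-1) ^ l * (conv (l + j) - conv l) ∧
      (-1) ^ l * (conv (l + j) - conv l) ≤ 1 / (q l * q (l + 1)) := by
  have hsq : ∀ l : ℕ, ((-1 : ℝ) ^ l) * (-1) ^ l = 1 := by
    intro l; rw [← mul_pow]; norm_num
  induction j generalizing l with
  | zero =>
    have h1 := q_cast_pos l
    have h2 := q_cast_pos (l + 1)
    simp; positivity
  | succ j ih =>
    obtain ⟨h1, h2⟩ := ih (l + 1)
    have h3 := conv_succ l
    have h4 : (-1) ^ l * (conv (l + (j + 1)) - conv l)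
        = 1 / (q l * q (l + 1)) - (-1) ^ (l + 1) * (conv (l + 1 + j) - conv (l + 1)) := by
      rw [show l + (j + 1) = l + 1 + j by ring, pow_succ]
      linear_combination (-1) ^ l * h3 + 1 / (q l * q (l + 1) : ℝ) * hsq l
    have h5 : (1 : ℝ) / (q (l + 1) * q (l + 1 + 1)) ≤ 1 / (q l * q (l + 1)) := by
      have a1 : (q l : ℝ) ≤ q (l + 1 + 1) := by exact_mod_cast q_mono (by omega)
      have a2 := q_cast_pos l
      have a3 := q_cast_pos (l + 1)
      rw [mul_comm]
      gcongr
    rw [h4]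
    constructor <;> linarith

lemma abs_conv_sub_conv_le {l n : ℕ} (h : l ≤ n) :
    |conv n - conv l| ≤ 1 / (q l : ℝ) ^ 2 := by
  obtain ⟨j, rfl⟩ := Nat.exists_eq_add_of_le h
  obtain ⟨h1, h2⟩ := conv_sub_conv j l
  have h3 : |conv (l + j) - conv l| = (-1) ^ l * (conv (l + j) - conv l) := by
    rw [← abs_of_nonneg h1, abs_mul, abs_pow, abs_neg, abs_one, one_pow, one_mul]
  rw [h3]
  refine h2.trans ?_
  have a1 : (q l : ℝ) ≤ q (l + 1) := by exact_mod_cast q_mono (by omega)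
  have a2 := q_cast_pos l
  rw [sq]
  gcongr

/-- Consecutive denominators at most double, so the first one to reach √N does not exceed 2√N. -/
lemma exists_q_near_sqrt {N n : ℕ} (hN : 0 < N) (hNn : N < q n) :
    ∃ l ≤ n, Real.sqrt N ≤ q l ∧ (q l : ℝ) ≤ 2 * Real.sqrt N := by
  classical
  have hN1 : (1 : ℝ) ≤ N := by exact_mod_cast hN
  have hs1 : 1 ≤ Real.sqrt N := Real.one_le_sqrt.2 hN1
  have hsN : Real.sqrt N ≤ N := Real.sqrt_le_self_iff.2 (Or.inr hN1)
  have hex : ∃ l, Real.sqrt N ≤ q l := ⟨n, hsN.trans (by exact_mod_cast hNn.le)⟩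
  refine ⟨Nat.find hex, Nat.find_min' hex (hsN.trans (by exact_mod_cast hNn.le)),
    Nat.find_spec hex, ?_⟩
  rcases hl : Nat.find hex with _ | l
  · have : q 0 = 1 := rfl
    rw [this]; push_cast; linarith
  · have hlt : ¬ Real.sqrt N ≤ q l := Nat.find_min hex (by omega)
    push Not at hlt
    have h1 : q (l + 1) ≤ 2 * q l := by
      have : p l ≤ q l := Nat.fib_mono (Nat.le_succ l)
      rw [q_succ]; omega
    have h2 : (q (l + 1) : ℝ) ≤ 2 * q l := by exact_mod_cast h1
    linarith

/-- Discrepancy of the orbits of length less than the denominator, in both directions. -/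
lemma abs_count_hit_sub_le (n N : ℕ) (hN : N < q n) (ε : ℤ) (hε : ε = 1 ∨ ε = -1) (u : ℕ)
    (hu : u < q n) :
    |∑ r ∈ Finset.range N, (if hit n (ε * (r + 1)) ≤ u then (1 : ℝ) else 0)
      - N * (((u : ℝ) + 1) / q n)| ≤ 5 * Real.sqrt N := by
  rcases Nat.eq_zero_or_pos N with rfl | hN0
  · simp
  obtain ⟨l, hln, hl1, hl2⟩ := exists_q_near_sqrt hN0 hN
  have hu0 : 0 ≤ ((u : ℝ) + 1) / q n := by positivity
  have hu1 : ((u : ℝ) + 1) / q n ≤ 1 := by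
    rw [div_le_one (q_cast_pos n)]; exact_mod_cast hu
  have hcop : IsCoprime (-ε * p l) (q l : ℤ) := by
    have h : IsCoprime (p l : ℤ) (q l : ℤ) := Nat.isCoprime_iff_coprime.2 (coprime_p_q l)
    rcases hε with rfl | rfl
    · simpa using h.neg_left
    · simpa using h
  have hβ : |-ε * conv n - ((-ε * p l : ℤ) : ℝ) / (q l : ℕ)| ≤ 1 / (q l : ℝ) ^ 2 := by
    have h1 : -ε * conv n - ((-ε * p l : ℤ) : ℝ) / (q l : ℕ) = -ε * (conv n - conv l) := by
      unfold conv; push_cast; ring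
    have h2 : |(-ε : ℝ)| = 1 := by rcases hε with rfl | rfl <;> simp
    rw [h1, abs_mul, h2, one_mul]
    exact abs_conv_sub_conv_le hln
  have hb := count_blocks (-ε * conv n) (-ε * p l) (q l) (q_pos l) hcop hβ _ hu0 hu1
    (N / q l) (N % q l) (-ε * conv n)
  rw [Nat.div_add_mod] at hb
  have hsum : ∀ r ∈ Finset.range N,
      (if Int.fract (-ε * conv n + r * (-ε * conv n)) < ((u : ℝ) + 1) / q n then (1 : ℝ) else 0)
        = if hit n (ε * (r + 1)) ≤ u then (1 : ℝ) else 0 := by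
    intro r _
    refine if_congr ?_ rfl rfl
    rw [hit_le_iff]
    rw [show -ε * conv n + r * (-ε * conv n) = -((ε * (r + 1) : ℤ) : ℝ) * conv n by
      push_cast; ring]
  rw [Finset.sum_congr rfl hsum] at hb
  refine hb.trans ?_
  have hs : Real.sqrt N * Real.sqrt N = N := Real.mul_self_sqrt (Nat.cast_nonneg N)
  have hs0 : 0 < Real.sqrt N := Real.sqrt_pos.2 (by exact_mod_cast hN0)
  -- At most √N full blocks cost 3 each and the incomplete one costs at most `q l` ≤ 2√N, which
  -- gives 5√N.
  have h1 : ((N / q l : ℕ) : ℝ) ≤ Real.sqrt N := by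
    refine Nat.cast_div_le.trans ?_
    rw [div_le_iff₀ (q_cast_pos l)]
    nlinarith
  have h2 : ((N % q l : ℕ) : ℝ) ≤ q l := by exact_mod_cast (Nat.mod_lt N (q_pos l)).le
  linarith

/-- Layer-cake decomposition: the summand is the indicator of u < k ≤ m. It turns counting estimates
into estimates for sums of hitting times. -/
lemma mul_indicator_le (k : ℤ) (hk : 0 ≤ k) (m : ℕ) :
    (if k ≤ m then (k : ℝ) else 0)
      = ∑ u ∈ Finset.range m, ((if k ≤ m then (1 : ℝ) else 0) - if k ≤ u then 1 else 0) := by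
  lift k to ℕ using hk
  simp only [Nat.cast_le, Int.cast_natCast]
  split_ifs with h
  · obtain ⟨j, rfl⟩ := Nat.exists_eq_add_of_le h
    rw [Finset.sum_range_add]
    have h1 : ∀ u ∈ Finset.range k, ((1 : ℝ) - if k ≤ u then 1 else 0) = 1 := by
      intro u hu
      rw [if_neg (by simpa using hu), sub_zero]
    rw [Finset.sum_congr rfl h1]
    simp
  · symm
    refine Finset.sum_eq_zero fun u hu => ?_
    rw [if_neg (by have := Finset.mem_range.1 hu; omega), sub_zero]

/-- The normalised hitting time, cut off at time `m`. -/
noncomputable def cutHit (n m : ℕ) (i : ℤ) : ℝ := if hit n i ≤ m then (hit n i : ℝ) / q n else 0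

lemma cutHit_nonneg (n m : ℕ) (i : ℤ) : 0 ≤ cutHit n m i := by
  unfold cutHit
  split_ifs
  · have : (0 : ℝ) ≤ hit n i := by exact_mod_cast hit_nonneg n i
    positivity
  · exact le_rfl

lemma cutHit_le_one (n m : ℕ) (i : ℤ) : cutHit n m i ≤ 1 := by
  unfold cutHit
  split_ifs
  · rw [div_le_one (q_cast_pos n)]
    exact_mod_cast (hit_lt n i).le
  · exact zero_le_one

/-- The counts along positive and along negative indices are both within 5√N of the same main term,
so they differ by at most 10√N at every level. Each layer involves two levels, and there are `m` <
`q n` layers to be divided by `q n`. -/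
lemma abs_sum_cutHit_sub_le (n m N : ℕ) (hN : N < q n) (hm : m < q n) :
    |∑ r ∈ Finset.range N, (cutHit n m (r + 1) - cutHit n m (-(r + 1)))| ≤ 20 * Real.sqrt N := by
  set C : ℤ → ℕ → ℝ := fun ε u =>
    ∑ r ∈ Finset.range N, (if hit n (ε * (r + 1)) ≤ u then (1 : ℝ) else 0) with hC
  have hdiff : ∀ u < q n, |C 1 u - C (-1) u| ≤ 10 * Real.sqrt N := by
    intro u hu
    have h1 := abs_le.1 (abs_count_hit_sub_le n N hN 1 (Or.inl rfl) u hu)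
    have h2 := abs_le.1 (abs_count_hit_sub_le n N hN (-1) (Or.inr rfl) u hu)
    rw [abs_le]
    constructor <;> simp only [hC] <;> linarith [h1.1, h1.2, h2.1, h2.2]
  have hcut : ∀ i : ℤ, cutHit n m i = (∑ u ∈ Finset.range m,
      ((if hit n i ≤ m then (1 : ℝ) else 0) - if hit n i ≤ u then 1 else 0)) / q n := by
    intro i
    rw [← mul_indicator_le _ (hit_nonneg n i), cutHit]
    split_ifs <;> simp
  have hsum : ∑ r ∈ Finset.range N, (cutHit n m (r + 1) - cutHit n m (-(r + 1)))
      = (∑ u ∈ Finset.range m, ((C 1 m - C (-1) m) - (C 1 u - C (-1) u))) / q n := by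
    simp only [hcut, ← sub_div, ← Finset.sum_div, ← Finset.sum_sub_distrib]
    rw [Finset.sum_comm]
    simp only [hC, ← Finset.sum_sub_distrib]
    congr 1
    refine Finset.sum_congr rfl fun u _ => Finset.sum_congr rfl fun r _ => ?_
    simp only [one_mul, neg_one_mul]
    ring
  have hle : |∑ u ∈ Finset.range m, ((C 1 m - C (-1) m) - (C 1 u - C (-1) u))|
      ≤ m * (20 * Real.sqrt N) := by
    refine (Finset.abs_sum_le_sum_abs _ _).trans ?_
    refine (Finset.sum_le_card_nsmul _ _ (20 * Real.sqrt N) fun u hu => ?_).trans (by simp)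
    have h1 := abs_le.1 (hdiff m hm)
    have h2 := abs_le.1 (hdiff u ((Finset.mem_range.1 hu).trans hm))
    rw [abs_le]
    constructor <;> linarith [h1.1, h1.2, h2.1, h2.2]
  rw [hsum, abs_div, abs_of_pos (q_cast_pos n), div_le_iff₀ (q_cast_pos n)]
  have hmq : (m : ℝ) ≤ q n := by exact_mod_cast hm.le
  refine hle.trans ?_
  rw [mul_comm]
  gcongr

/-! ### Concavity of the logarithmic kernel -/

lemma sin_pi_mul_pos {x : ℝ} (hx : x ∈ Ioo (0 : ℝ) 1) : 0 < Real.sin (Real.pi * x) :=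
  Real.sin_pos_of_pos_of_lt_pi (mul_pos Real.pi_pos hx.1)
    (by nlinarith [Real.pi_pos, hx.2])

lemma concaveOn_logKernel : ConcaveOn ℝ (Ioo (0 : ℝ) 1) logKernel := by
  refine ⟨convex_Ioo 0 1, fun x hx y hy a b ha hb hab => ?_⟩
  have hpi := Real.pi_pos
  have hsx := sin_pi_mul_pos hx
  have hsy := sin_pi_mul_pos hy
  have hIcc : ∀ z ∈ Ioo (0 : ℝ) 1, Real.pi * z ∈ Icc 0 Real.pi := fun z hz =>
    ⟨by have := hz.1; positivity, by nlinarith [hz.2]⟩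
  have h1 := strictConcaveOn_sin_Icc.concaveOn.2 (hIcc x hx) (hIcc y hy) ha hb hab
  have h2 := strictConcaveOn_log_Ioi.concaveOn.2
    (show 2 * Real.sin (Real.pi * x) ∈ Ioi (0 : ℝ) from by simpa using hsx)
    (show 2 * Real.sin (Real.pi * y) ∈ Ioi (0 : ℝ) from by simpa using hsy) ha hb hab
  simp only [smul_eq_mul] at h1 h2 ⊢
  have hpos : 0 < a * (2 * Real.sin (Real.pi * x)) + b * (2 * Real.sin (Real.pi * y)) := by
    rcases ha.eq_or_lt with rfl | ha'
    · have : b = 1 := by linarith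
      subst this; linarith
    · positivity
  have h3 : Real.log (a * (2 * Real.sin (Real.pi * x)) + b * (2 * Real.sin (Real.pi * y)))
      ≤ Real.log (2 * Real.sin (Real.pi * (a * x + b * y))) := by
    refine Real.log_le_log hpos ?_
    rw [show Real.pi * (a * x + b * y) = a * (Real.pi * x) + b * (Real.pi * y) by ring]
    linarith
  rw [logKernel_eq, logKernel_eq, logKernel_eq]
  linarith

lemma concaveOn_logKernel_int (l : ℤ) : ConcaveOn ℝ (Ioo (l : ℝ) (l + 1)) logKernel := by
  have h := concaveOn_logKernel.translate_right (-(l : ℝ))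
  have h2 : (fun z : ℝ => -(l : ℝ) + z) ⁻¹' Ioo (0 : ℝ) 1 = Ioo (l : ℝ) (l + 1) := by
    ext z; simp only [mem_preimage, mem_Ioo]
    constructor <;> rintro ⟨h1, h2⟩ <;> constructor <;> linarith
  rw [h2] at h
  have h3 : (logKernel ∘ fun z : ℝ => -(l : ℝ) + z) = logKernel := by
    ext z
    have := logKernel_add_int z (-l)
    push_cast at this
    rw [← this, Function.comp, add_comm]
  rwa [h3] at h

lemma hasDerivAt_logKernel {x : ℝ} (hx : x ∈ Ioo (0 : ℝ) 1) :
    HasDerivAt logKernel (2 * Real.pi * Real.cot (Real.pi * x)) x := by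
  have hs := sin_pi_mul_pos hx
  have h1 : HasDerivAt (fun x : ℝ => Real.pi * x) Real.pi x := by
    simpa using (hasDerivAt_id x).const_mul Real.pi
  have h2 := ((((Real.hasDerivAt_sin (Real.pi * x)).comp x h1).const_mul 2).log
    (by simpa using hs.ne')).const_mul 2
  have h3 : logKernel = fun x => 2 * Real.log (2 * (Real.sin ∘ fun x => Real.pi * x) x) := by
    ext z; rw [logKernel_eq]; rfl
  rw [h3]
  refine h2.congr_deriv ?_
  rw [Real.cot_eq_cos_div_sin, Function.comp]
  field_simp

lemma logKernel_sub_le {x y : ℝ} (hx : x ∈ Ioo (0 : ℝ) 1) (hy : y ∈ Ioo (0 : ℝ) 1) :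
    logKernel y - logKernel x ≤ 2 * Real.pi * Real.cot (Real.pi * x) * (y - x) := by
  rcases lt_trichotomy x y with h | rfl | h
  · have := concaveOn_logKernel.slope_le_of_hasDerivAt hx hy h (hasDerivAt_logKernel hx)
    rwa [slope_def_field, div_le_iff₀ (by linarith)] at this
  · simp
  · have := concaveOn_logKernel.le_slope_of_hasDerivAt hy hx h (hasDerivAt_logKernel hx)
    rw [slope_def_field, le_div_iff₀ (by linarith)] at this
    linarith

lemma cot_sub_cot {a b : ℝ} (ha : Real.sin a ≠ 0) (hb : Real.sin b ≠ 0) :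
    Real.cot a - Real.cot b = Real.sin (b - a) / (Real.sin a * Real.sin b) := by
  rw [Real.cot_eq_cos_div_sin, Real.cot_eq_cos_div_sin, Real.sin_sub]
  field_simp

/-- The tangents of a concave function at both endpoints bound the error by (y - x)(g'(x) - g'(y)).
The difference of cotangents is explicit, so no second derivative is needed. -/
lemma abs_logKernel_sub_tangent_le {x y : ℝ} (hx : x ∈ Ioo (0 : ℝ) 1) (hy : y ∈ Ioo (0 : ℝ) 1) :
    |logKernel y - logKernel x - 2 * Real.pi * Real.cot (Real.pi * x) * (y - x)|
      ≤ 2 * Real.pi ^ 2 * (y - x) ^ 2 / (Real.sin (Real.pi * x) * Real.sin (Real.pi * y)) := by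
  have h1 := logKernel_sub_le hx hy
  have h2 := logKernel_sub_le hy hx
  have hsx := sin_pi_mul_pos hx
  have hsy := sin_pi_mul_pos hy
  have hpi := Real.pi_pos
  have h3 : |logKernel y - logKernel x - 2 * Real.pi * Real.cot (Real.pi * x) * (y - x)|
      ≤ 2 * Real.pi * (y - x) * (Real.cot (Real.pi * x) - Real.cot (Real.pi * y)) := by
    rw [abs_le]; constructor <;> nlinarith
  refine h3.trans ?_
  rw [cot_sub_cot hsx.ne' hsy.ne', ← mul_div_assoc]
  refine div_le_div_of_nonneg_right ?_ (by positivity)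
  have h4 : (y - x) * Real.sin (Real.pi * y - Real.pi * x) ≤ Real.pi * (y - x) ^ 2 := by
    refine (le_abs_self _).trans ?_
    rw [abs_mul]
    have h5 : |Real.sin (Real.pi * y - Real.pi * x)| ≤ |Real.pi * y - Real.pi * x| :=
      Real.abs_sin_le_abs
    calc |y - x| * |Real.sin (Real.pi * y - Real.pi * x)|
        ≤ |y - x| * |Real.pi * y - Real.pi * x| := by gcongr
      _ = Real.pi * (y - x) ^ 2 := by
        rw [← mul_sub, abs_mul, abs_of_pos hpi, ← sq_abs (y - x)]; ring
  nlinarith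

lemma two_mul_le_sin_pi {x δ : ℝ} (h0 : 0 ≤ δ) (h1 : δ ≤ x) (h2 : δ ≤ 1 - x) :
    2 * δ ≤ Real.sin (Real.pi * x) := by
  have hpi := Real.pi_pos
  have aux : ∀ z : ℝ, 0 ≤ z → z ≤ 1 / 2 → 2 * z ≤ Real.sin (Real.pi * z) := by
    intro z hz0 hz1
    have := Real.mul_le_sin (x := Real.pi * z) (by positivity) (by nlinarith)
    calc 2 * z = 2 / Real.pi * (Real.pi * z) := by field_simp
      _ ≤ _ := this
  rcases le_total x (1 / 2) with h | h
  · have := aux x (h0.trans h1) h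
    linarith
  · have := aux (1 - x) (h0.trans h2) (by linarith)
    rw [mul_sub Real.pi, mul_one, Real.sin_pi_sub] at this
    linarith

/-- Second order remainder at the grid points. -/
lemma abs_remainder_le {Q : ℝ} (j : ℕ) (hj : 1 ≤ j) (hjQ : 2 * (j : ℝ) ≤ Q) {ρ s : ℝ}
    (hρ0 : 0 ≤ ρ) (hρ : ρ < 1) (hs : |s| ≤ ρ / Q) :
    |logKernel (j / Q + s) - logKernel (j / Q) - 2 * Real.pi * Real.cot (Real.pi * (j / Q)) * s|
      ≤ Real.pi ^ 2 / (2 * (1 - ρ)) * (1 / (j : ℝ) ^ 2) := by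
  have hj' : (1 : ℝ) ≤ j := by exact_mod_cast hj
  have hQ : 0 < Q := by linarith
  have hpi := Real.pi_pos
  obtain ⟨hs1, hs2⟩ := abs_le.1 hs
  have hjq : (j : ℝ) / Q ≤ 1 / 2 := by rw [div_le_iff₀ hQ]; linarith
  have hjq0 : 0 < (j : ℝ) / Q := by positivity
  have hρQ : ρ / Q < 1 / Q := by gcongr
  have h1Q : 1 / Q ≤ j / Q := by gcongr
  have hx : (j : ℝ) / Q ∈ Ioo (0 : ℝ) 1 := ⟨hjq0, by linarith⟩
  have hy : (j : ℝ) / Q + s ∈ Ioo (0 : ℝ) 1 := ⟨by linarith, by linarith⟩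
  have h := abs_logKernel_sub_tangent_le hx hy
  rw [add_sub_cancel_left] at h
  refine h.trans ?_
  have hb1 : 2 * (j / Q) ≤ Real.sin (Real.pi * (j / Q)) :=
    two_mul_le_sin_pi hjq0.le le_rfl (by linarith)
  -- Since j ≥ 1, a shift of at most ρ/Q removes at most the proportion ρ of the distance j/Q to the
  -- pole.
  have hb2 : 2 * ((1 - ρ) * (j / Q)) ≤ Real.sin (Real.pi * (j / Q + s)) := by
    have : ρ / Q ≤ ρ * (j / Q) := by
      rw [← mul_div_assoc]; gcongr; nlinarith
    refine two_mul_le_sin_pi (mul_nonneg (by linarith) hjq0.le) ?_ ?_ <;> linarith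
  have hs3 : s ^ 2 ≤ 1 / Q ^ 2 := by
    rw [← sq_abs, ← one_div_pow]
    exact pow_le_pow_left₀ (abs_nonneg s) (hs.trans hρQ.le) 2
  have hρ1 : 0 < 1 - ρ := by linarith
  have hsx := (sin_pi_mul_pos hx).le
  calc 2 * Real.pi ^ 2 * s ^ 2
        / (Real.sin (Real.pi * (j / Q)) * Real.sin (Real.pi * (j / Q + s)))
      ≤ 2 * Real.pi ^ 2 * (1 / Q ^ 2) / (2 * (j / Q) * (2 * ((1 - ρ) * (j / Q)))) := by
        gcongr
    _ = Real.pi ^ 2 / (2 * (1 - ρ)) * (1 / (j : ℝ) ^ 2) := by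
        field_simp

/-! ### Reordering Birkhoff sums along the grid -/

/-- Centring the residues puts the pole in the middle, so that i and -i can be paired. For even Q
the midpoint goes to the positive half. -/
lemma sum_range_periodic (Q : ℕ) (F : ℤ → ℝ) (hF : ∀ i, F (i + Q) = F i) :
    ∑ i ∈ Finset.range (Q - 1), F (i + 1)
      = ∑ r ∈ Finset.range (Q / 2), F (r + 1)
        + ∑ r ∈ Finset.range ((Q - 1) / 2), F (-(r + 1)) := by
  rw [show Q - 1 = Q / 2 + (Q - 1) / 2 by omega, Finset.sum_range_add,
    show (Q / 2 + (Q - 1) / 2) / 2 = (Q - 1) / 2 by omega]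
  congr 1
  rw [← Finset.sum_range_reflect]
  refine Finset.sum_congr rfl fun r hr => ?_
  have hr := Finset.mem_range.1 hr
  rw [← hF (-(r + 1))]
  congr 1
  omega

lemma hit_injOn (n : ℕ) {i j : ℤ} (h : hit n i = hit n j) : (q n : ℤ) ∣ i - j := by
  have h1 : (q n : ℤ) ∣ (i - j) * p n := by
    have := Int.ModEq.dvd h
    convert this using 1; ring
  have hcop : IsCoprime (p n : ℤ) (q n : ℤ) := Nat.isCoprime_iff_coprime.2 (coprime_p_q n)
  exact hcop.symm.dvd_of_dvd_mul_right h1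

lemma hit_zero (n : ℕ) : hit n 0 = 0 := by simp [hit]

lemma hit_add_q (n : ℕ) (i : ℤ) : hit n (i + q n) = hit n i := by
  unfold hit
  rw [show -(i + (q n : ℤ)) * p n = -i * p n + (q n : ℤ) * (-p n) by ring,
    Int.add_mul_emod_self_left]

lemma hit_pos (n : ℕ) {i : ℤ} (hi : ¬ (q n : ℤ) ∣ i) : 0 < hit n i := by
  refine lt_of_le_of_ne (hit_nonneg n i) fun h => hi ?_
  rw [← hit_zero n] at h
  simpa using hit_injOn n h.symm

lemma sum_Icc_eq_sum_hit (n m : ℕ) (hm : m < q n) (G : ℝ → ℝ) :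
    ∑ k ∈ Finset.Icc 1 m, G k
      = ∑ r ∈ Finset.range (q n / 2), (if hit n (r + 1) ≤ m then G (hit n (r + 1)) else 0)
        + ∑ r ∈ Finset.range ((q n - 1) / 2),
          (if hit n (-(r + 1)) ≤ m then G (hit n (-(r + 1))) else 0) := by
  have h1 : ∑ k ∈ Finset.Icc 1 m, G k
      = ∑ k ∈ Finset.Icc 1 (q n - 1), if k ≤ m then G k else 0 := by
    rw [← Finset.sum_filter]
    refine Finset.sum_congr ?_ fun _ _ => rfl
    ext k
    simp only [Finset.mem_Icc, Finset.mem_filter]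
    omega
  have hdvd : ∀ i ∈ Finset.Icc 1 (q n - 1), ¬ (q n : ℤ) ∣ (i : ℤ) := by
    intro i hi hd
    rw [Finset.mem_Icc] at hi
    have := Nat.le_of_dvd (by omega) (Int.natCast_dvd_natCast.1 hd)
    omega
  have hmaps : Set.MapsTo (fun i : ℕ => (hit n i).toNat)
      (Finset.Icc 1 (q n - 1) : Finset ℕ) (Finset.Icc 1 (q n - 1) : Finset ℕ) := by
    intro i hi
    have h1 := hit_pos n (hdvd i hi)
    have h2 := hit_lt n i
    simp only [Finset.coe_Icc, mem_Icc]
    omega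
  have hinj : Set.InjOn (fun i : ℕ => (hit n i).toNat)
      (Finset.Icc 1 (q n - 1) : Finset ℕ) := by
    intro i hi j hj hij
    have h1 := hit_nonneg n i
    have h2 := hit_nonneg n j
    have h3 := hit_injOn n (show hit n i = hit n j by dsimp only at hij; omega)
    simp only [Finset.coe_Icc, mem_Icc] at hi hj
    have := Int.eq_zero_of_abs_lt_dvd h3 (by rw [abs_lt]; omega)
    omega
  have h2 : ∑ k ∈ Finset.Icc 1 (q n - 1), (if k ≤ m then G k else 0)
      = ∑ i ∈ Finset.Icc 1 (q n - 1), if hit n (i : ℕ) ≤ m then G (hit n (i : ℕ)) else 0 := by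
    symm
    refine Finset.sum_nbij (fun i : ℕ => (hit n i).toNat) hmaps hinj
      (Finset.surjOn_of_injOn_of_card_le _ hmaps hinj le_rfl) fun i _ => ?_
    have h1 := hit_nonneg n i
    obtain ⟨k, hk⟩ := Int.eq_ofNat_of_zero_le h1
    simp [hk]
  rw [h1, h2, sum_Icc_one]
  have h3 := sum_range_periodic (q n) (fun i => if hit n i ≤ m then G (hit n i) else 0)
    (fun i => by simp only [hit_add_q])
  simpa using h3

/-- Perturbing the rotation number of the convergent shifts the grid points. -/
lemma logKernel_hit_mul (n : ℕ) (i : ℤ) (d : ℝ) :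
    logKernel (hit n i * (conv n + (-1) ^ n * d)) = logKernel (i / q n + hit n i * d) := by
  have hsq : ((-1 : ℝ) ^ n) * (-1) ^ n = 1 := by
    rw [← mul_pow]; norm_num
  have hp : (p n : ℝ) * p n = (q n - p n) * q n - (-1) ^ n := by exact_mod_cast p_sq n
  have hq := q_cast_ne n
  rw [← logKernel_neg_one_pow_mul n,
    ← logKernel_add_int (i / q n + hit n i * d)
      ((-1) ^ n * (-i * (q n - p n) - ⌊-i * conv n⌋ * p n))]
  congr 1
  have h1 : (hit n i : ℝ) * conv n = -i * (q n - p n) - ⌊-i * conv n⌋ * p n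
      + (-1) ^ n * (i / q n) := by
    rw [hit_eq]
    unfold conv
    field_simp
    linear_combination -(i : ℝ) * hp
  push_cast
  linear_combination (-1) ^ n * h1 + ((hit n i : ℝ) * d + i / q n) * hsq

/-! ### Limits on the scale of the grid -/

variable {l : Filter ℕ}

lemma tendsto_div_q {u : ℕ → ℝ} {a : ℝ} (hl : l ≤ atTop) (hu : Tendsto u l (𝓝 a)) :
    Tendsto (fun n => u n / q n) l (𝓝 0) :=
  hu.div_atTop (tendsto_q.mono_left hl)

lemma sin_eq_mul_sinc (x : ℝ) : Real.sin x = x * Real.sinc x := by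
  rcases eq_or_ne x 0 with rfl | h
  · simp
  · rw [Real.sinc_of_ne_zero h]; field_simp

lemma tendsto_sinc_zero {u : ℕ → ℝ} (hu : Tendsto u l (𝓝 0)) :
    Tendsto (fun n => Real.sinc (u n)) l (𝓝 1) := by
  have := (Real.continuous_sinc.tendsto 0).comp hu
  rwa [Real.sinc_zero] at this

lemma tendsto_logKernel_div_q {u : ℕ → ℝ} {a : ℝ} (hl : l ≤ atTop) (ha : 0 < a)
    (hu : Tendsto u l (𝓝 a)) :
    Tendsto (fun n => logKernel (u n / q n) + 2 * Real.log (q n)) l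
      (𝓝 (2 * Real.log (2 * Real.pi * a))) := by
  have hw : Tendsto (fun n => Real.pi * (u n / q n)) l (𝓝 0) := by
    simpa using (tendsto_div_q hl hu).const_mul Real.pi
  have hsinc := tendsto_sinc_zero hw
  have hpi := Real.pi_pos
  have hlim : Tendsto (fun n => 2 * Real.log (2 * Real.pi * u n * Real.sinc (Real.pi * (u n / q n))))
      l (𝓝 (2 * Real.log (2 * Real.pi * a))) := by
    have h1 : Tendsto (fun n => 2 * Real.pi * u n * Real.sinc (Real.pi * (u n / q n))) l
        (𝓝 (2 * Real.pi * a)) := by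
      simpa using (hu.const_mul (2 * Real.pi)).mul hsinc
    exact (h1.log (by positivity)).const_mul 2
  refine hlim.congr' ?_
  filter_upwards [hu.eventually_const_lt ha, hsinc.eventually_const_lt one_pos] with n h1 h2
  have hq := q_cast_pos n
  rw [logKernel_eq, sin_eq_mul_sinc, ← mul_add, ← Real.log_mul (by positivity) hq.ne']
  congr 2
  field_simp

lemma tendsto_cot_div_q (hl : l ≤ atTop) {a : ℝ} (ha : 0 < a) :
    Tendsto (fun n => Real.cot (Real.pi * (a / q n)) / q n) l (𝓝 (1 / (Real.pi * a))) := by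
  have hpi := Real.pi_pos
  have hw : Tendsto (fun n => Real.pi * (a / q n)) l (𝓝 0) := by
    simpa using (tendsto_div_q hl (tendsto_const_nhds (x := a))).const_mul Real.pi
  have hcos : Tendsto (fun n => Real.cos (Real.pi * (a / q n))) l (𝓝 1) := by
    have := (Real.continuous_cos.tendsto 0).comp hw
    rwa [Real.cos_zero] at this
  have h := hcos.div ((tendsto_sinc_zero hw).const_mul (Real.pi * a)) (by positivity)
  rw [mul_one] at h
  refine h.congr fun n => ?_
  have hq := q_cast_pos n
  simp only [Pi.div_apply]
  rw [Real.cot_eq_cos_div_sin, sin_eq_mul_sinc, div_div]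
  congr 1
  field_simp

/-- The deviation of the kernel from its tangent at a grid point. -/
noncomputable def gridRem (Q : ℝ) (j : ℕ) (s : ℝ) : ℝ :=
  logKernel (j / Q + s) - logKernel (j / Q) - 2 * Real.pi * Real.cot (Real.pi * (j / Q)) * s

lemma tsum_ite_lt_eq_sum (M : ℕ) (f : ℕ → ℝ) :
    ∑' r, (if r < M then f r else 0) = ∑ r ∈ Finset.range M, f r := by
  rw [tsum_eq_sum (s := Finset.range M) fun r hr => if_neg (by simpa using hr)]
  exact Finset.sum_congr rfl fun r hr => if_pos (Finset.mem_range.1 hr)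

lemma summable_one_div_succ_sq : Summable fun r : ℕ => 1 / ((r + 1 : ℕ) : ℝ) ^ 2 :=
  (summable_nat_add_iff (f := fun r : ℕ => 1 / (r : ℝ) ^ 2) 1).2
    (Real.summable_one_div_nat_pow.2 one_lt_two)

/-- Termwise, the divergent parts 2 log `q n` of the two kernel values cancel and the tangent term
tends to 2z/(r + 1). `abs_remainder_le` provides the summable majorant; ρ < 1 keeps it uniform in
`n`. -/
lemma tendsto_sum_gridRem (hl : l ≤ atTop) {M : ℕ → ℕ} (hM : Tendsto M l atTop)
    (hMq : ∀ n, 2 * M n ≤ q n) {ρ : ℝ} (hρ0 : 0 ≤ ρ) (hρ : ρ < 1) {s : ℕ → ℕ → ℝ} {z : ℕ → ℝ}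
    (hs : ∀ᶠ n in l, ∀ r, |s n r| ≤ ρ / q n)
    (hz : ∀ r, Tendsto (fun n => q n * s n r) l (𝓝 (z r))) (hz1 : ∀ r, -1 < z r) :
    Tendsto (fun n => ∑ r ∈ Finset.range (M n), gridRem (q n) (r + 1) (s n r)) l
      (𝓝 (∑' r : ℕ, (2 * Real.log (1 + z r / (r + 1)) - 2 * (z r / (r + 1))))) := by
  have hpi := Real.pi_pos
  simp only [← tsum_ite_lt_eq_sum]
  refine tendsto_tsum_of_dominated_convergence
    (bound := fun r : ℕ => Real.pi ^ 2 / (2 * (1 - ρ)) * (1 / ((r + 1 : ℕ) : ℝ) ^ 2))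
    (summable_one_div_succ_sq.mul_left _) (fun r => ?_) ?_
  · have hr : (0 : ℝ) < (r + 1 : ℕ) := by positivity
    have hr1 : (1 : ℝ) ≤ (r + 1 : ℕ) := by exact_mod_cast Nat.le_add_left 1 r
    have h1 : Tendsto (fun n => ((r + 1 : ℕ) : ℝ) + q n * s n r) l (𝓝 ((r + 1 : ℕ) + z r)) :=
      tendsto_const_nhds.add (hz r)
    have hpos : 0 < ((r + 1 : ℕ) : ℝ) + z r := by linarith [hz1 r]
    have h2 := (tendsto_logKernel_div_q hl hpos h1).sub
      (tendsto_logKernel_div_q hl hr (tendsto_const_nhds (x := ((r + 1 : ℕ) : ℝ))))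
    have h3 := ((tendsto_cot_div_q hl hr).mul (hz r)).const_mul (2 * Real.pi)
    have h4 := h2.sub h3
    have hlim : 2 * Real.log (2 * Real.pi * ((r + 1 : ℕ) + z r))
          - 2 * Real.log (2 * Real.pi * (r + 1 : ℕ))
          - 2 * Real.pi * (1 / (Real.pi * (r + 1 : ℕ)) * z r)
        = 2 * Real.log (1 + z r / (r + 1)) - 2 * (z r / (r + 1)) := by
      have e1 : 2 * Real.pi * ((r + 1 : ℕ) + z r) / (2 * Real.pi * (r + 1 : ℕ))
          = 1 + z r / (r + 1) := by
        push_cast at hr ⊢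
        field_simp
      have e2 : 2 * Real.pi * (1 / (Real.pi * (r + 1 : ℕ)) * z r) = 2 * (z r / (r + 1)) := by
        push_cast at hr ⊢
        field_simp
      rw [← mul_sub, ← Real.log_div (by positivity) (by positivity), e1, e2]
    rw [← hlim]
    refine h4.congr' ?_
    filter_upwards [hM.eventually_gt_atTop r] with n hn
    have hq := q_cast_ne n
    rw [if_pos hn, gridRem, add_div, mul_div_cancel_left₀ _ hq]
    field_simp
    ring
  · filter_upwards [hs] with n hn r
    split_ifs with hr
    · rw [Real.norm_eq_abs]
      refine abs_remainder_le (r + 1) (by omega) ?_ hρ0 hρ (hn r)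
      have := hMq n
      exact_mod_cast (show 2 * (r + 1) ≤ q n by omega)
    · rw [norm_zero]
      have : 0 < 1 - ρ := by linarith
      positivity

/-! ### Summation by parts for the linear part -/

lemma sum_mul_eq_sum_by_parts (c h : ℕ → ℝ) (M : ℕ) :
    ∑ r ∈ Finset.range M, c r * h r
      = ∑ r ∈ Finset.range M, (c r - c (r + 1)) * ∑ k ∈ Finset.range (r + 1), h k
        + c M * ∑ k ∈ Finset.range M, h k := by
  induction M with
  | zero => simp
  | succ M ih =>
    rw [Finset.sum_range_succ, ih, Finset.sum_range_succ, Finset.sum_range_succ _ M]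
    ring

/-- The cotangent weights, cut off at the middle of the grid. -/
noncomputable def cotWeight (n r : ℕ) : ℝ :=
  if r < q n / 2 then Real.cot (Real.pi * (((r + 1 : ℕ) : ℝ) / q n)) / q n else 0

/-- Inside the range this is the cotangent difference formula with sin(πx) ≥ 2x. At the cut-off the
jump is as small, because the cotangent vanishes at π/2 and the last grid point is within 1/(2 `q
n`) of 1/2. -/
lemma abs_cotWeight_sub_le (n r : ℕ) :
    |cotWeight n r - cotWeight n (r + 1)| ≤ Real.pi / 4 * (1 / ((r + 1 : ℕ) : ℝ) ^ 2) := by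
  have hpi := Real.pi_pos
  have hq := q_cast_pos n
  have hr0 : (0 : ℝ) < (r + 1 : ℕ) := by positivity
  unfold cotWeight
  rcases lt_trichotomy (r + 1) (q n / 2) with h | h | h
  · have h2 : 2 * (r + 1 + 1) ≤ q n := by omega
    have h2' : 2 * ((r + 1 + 1 : ℕ) : ℝ) ≤ q n := by exact_mod_cast h2
    rw [if_pos (by omega), if_pos h]
    set x : ℝ := ((r + 1 : ℕ) : ℝ) / q n with hx
    have hy : ((r + 1 + 1 : ℕ) : ℝ) / q n = x + 1 / q n := by
      rw [hx]; push_cast; ring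
    have hx0 : 0 < x := by positivity
    have hq1 : 0 < 1 / (q n : ℝ) := by positivity
    have hy1 : x + 1 / q n ≤ 1 / 2 := by
      rw [← hy, div_le_iff₀ hq]; linarith
    have hsx : 2 * x ≤ Real.sin (Real.pi * x) := two_mul_le_sin_pi hx0.le le_rfl (by linarith)
    have hsy : 2 * x ≤ Real.sin (Real.pi * (x + 1 / q n)) :=
      two_mul_le_sin_pi hx0.le (by linarith) (by linarith)
    have hsx0 : 0 < Real.sin (Real.pi * x) := by linarith
    have hsy0 : 0 < Real.sin (Real.pi * (x + 1 / q n)) := by linarith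
    rw [hy, ← sub_div, cot_sub_cot hsx0.ne' hsy0.ne']
    have hs : Real.pi * (x + 1 / q n) - Real.pi * x = Real.pi * (1 / q n) := by ring
    have hs0 : 0 ≤ Real.sin (Real.pi * (1 / q n)) :=
      Real.sin_nonneg_of_nonneg_of_le_pi (by positivity)
        (mul_le_of_le_one_right hpi.le (by linarith))
    rw [hs, abs_of_nonneg (by positivity)]
    calc Real.sin (Real.pi * (1 / q n))
          / (Real.sin (Real.pi * x) * Real.sin (Real.pi * (x + 1 / q n))) / q n
        ≤ Real.pi * (1 / q n) / (2 * x * (2 * x)) / q n := by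
          have := Real.sin_le (show 0 ≤ Real.pi * (1 / q n) by positivity)
          gcongr
      _ = Real.pi / 4 * (1 / ((r + 1 : ℕ) : ℝ) ^ 2) := by
          rw [hx]; field_simp; norm_num
  · rw [if_pos (by omega), if_neg (by omega), sub_zero]
    have h2 : 2 * ((r + 1 : ℕ) : ℝ) ≤ q n := by exact_mod_cast (show 2 * (r + 1) ≤ q n by omega)
    have h3 : (q n : ℝ) ≤ 2 * ((r + 1 : ℕ) : ℝ) + 1 := by
      exact_mod_cast (show q n ≤ 2 * (r + 1) + 1 by omega)
    set x : ℝ := ((r + 1 : ℕ) : ℝ) / q n with hx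
    have hx0 : 0 < x := by positivity
    have hx1 : x ≤ 1 / 2 := by rw [hx, div_le_iff₀ hq]; linarith
    have hx2 : 1 / 2 - x ≤ 1 / (2 * q n) := by
      rw [hx, sub_le_iff_le_add, div_add_div _ _ (by positivity) (by positivity),
        div_le_div_iff₀ two_pos (by positivity)]
      nlinarith
    have hsx : 2 * x ≤ Real.sin (Real.pi * x) := two_mul_le_sin_pi hx0.le le_rfl (by linarith)
    have hc : Real.cos (Real.pi * x) ≤ Real.pi * (1 / (2 * q n)) := by
      rw [← Real.sin_pi_div_two_sub, show Real.pi / 2 - Real.pi * x = Real.pi * (1 / 2 - x) by ring]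
      refine (Real.sin_le (mul_nonneg hpi.le (by linarith))).trans ?_
      gcongr
    have hc0 : 0 ≤ Real.cos (Real.pi * x) :=
      Real.cos_nonneg_of_neg_pi_div_two_le_of_le (by nlinarith) (by nlinarith)
    rw [Real.cot_eq_cos_div_sin, abs_of_nonneg (by
      have : 0 < Real.sin (Real.pi * x) := by linarith
      positivity)]
    calc Real.cos (Real.pi * x) / Real.sin (Real.pi * x) / q n
        ≤ Real.pi * (1 / (2 * q n)) / (2 * x) / q n := by gcongr
      _ = Real.pi / 4 * (1 / ((r + 1 : ℕ) * q n)) := by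
          rw [hx]; field_simp; norm_num
      _ ≤ Real.pi / 4 * (1 / ((r + 1 : ℕ) : ℝ) ^ 2) := by
          rw [sq]
          have : ((r + 1 : ℕ) : ℝ) ≤ q n := by linarith
          gcongr
  · rw [if_neg (by omega), if_neg (by omega), sub_zero, abs_zero]
    positivity

lemma tendsto_q_half (hl : l ≤ atTop) : Tendsto (fun n => q n / 2) l atTop :=
  (Nat.tendsto_div_const_atTop two_ne_zero).comp
    ((tendsto_natCast_atTop_iff.1 tendsto_q).mono_left hl)

lemma tendsto_q_sub_one_half (hl : l ≤ atTop) : Tendsto (fun n => (q n - 1) / 2) l atTop :=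
  (Nat.tendsto_div_const_atTop two_ne_zero).comp
    ((tendsto_sub_atTop_nat 1).comp ((tendsto_natCast_atTop_iff.1 tendsto_q).mono_left hl))

lemma tendsto_cotWeight (hl : l ≤ atTop) (r : ℕ) :
    Tendsto (fun n => cotWeight n r) l (𝓝 (1 / (Real.pi * (r + 1 : ℕ)))) := by
  refine (tendsto_cot_div_q hl (a := (r + 1 : ℕ)) (by positivity)).congr' ?_
  filter_upwards [(tendsto_q_half hl).eventually_gt_atTop r] with n hn
  rw [cotWeight, if_pos hn]

lemma summable_sqrt_bound (C : ℝ) :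
    Summable fun r : ℕ => C * (Real.sqrt (r + 1 : ℕ) * (1 / ((r + 1 : ℕ) : ℝ) ^ 2)) := by
  refine Summable.mul_left _ ?_
  have h := (summable_nat_add_iff (f := fun r : ℕ => ((r : ℝ) ^ (3 / 2 : ℝ))⁻¹) 1).2
    (Real.summable_nat_rpow_inv.2 (by norm_num))
  refine h.congr fun r => ?_
  have hr : (0 : ℝ) < (r + 1 : ℕ) := by positivity
  rw [Real.sqrt_eq_rpow, ← Real.rpow_neg hr.le, one_div (((r + 1 : ℕ) : ℝ) ^ 2),
    ← Real.rpow_natCast, ← Real.rpow_neg hr.le, ← Real.rpow_add hr]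
  norm_num

/-- Summation by parts moves the decay to the weights: differences of order r^{-2} against partial
sums of order r^{1/2} give the majorant r^{-3/2}. The boundary term is zero because `cotWeight` is
cut off there. -/
lemma tendsto_linear_part (hl : l ≤ atTop) {h : ℕ → ℕ → ℝ} {z : ℕ → ℝ} {C : ℝ} (hC : 0 ≤ C)
    (hz : ∀ r, Tendsto (fun n => h n r) l (𝓝 (z r)))
    (hbound : ∀ᶠ n in l, ∀ N < q n, |∑ r ∈ Finset.range N, h n r| ≤ C * Real.sqrt N) :
    Tendsto (fun n => ∑ r ∈ Finset.range (q n / 2),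
        Real.cot (Real.pi * (((r + 1 : ℕ) : ℝ) / q n)) / q n * h n r) l
      (𝓝 (∑' r : ℕ, (1 / (Real.pi * (r + 1 : ℕ)) - 1 / (Real.pi * (r + 1 + 1 : ℕ)))
        * ∑ k ∈ Finset.range (r + 1), z k)) := by
  have hparts : ∀ n, ∑ r ∈ Finset.range (q n / 2),
      Real.cot (Real.pi * (((r + 1 : ℕ) : ℝ) / q n)) / q n * h n r
      = ∑' r, (cotWeight n r - cotWeight n (r + 1)) * ∑ k ∈ Finset.range (r + 1), h n k := by
    intro n
    have h1 : ∑ r ∈ Finset.range (q n / 2),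
        Real.cot (Real.pi * (((r + 1 : ℕ) : ℝ) / q n)) / q n * h n r
        = ∑ r ∈ Finset.range (q n / 2), cotWeight n r * h n r :=
      Finset.sum_congr rfl fun r hr => by rw [cotWeight, if_pos (Finset.mem_range.1 hr)]
    have h2 : cotWeight n (q n / 2) = 0 := if_neg (lt_irrefl _)
    rw [h1, sum_mul_eq_sum_by_parts, h2, zero_mul, add_zero,
      tsum_eq_sum (s := Finset.range (q n / 2))]
    intro r hr
    have hr' : ¬ r < q n / 2 := by simpa using hr
    rw [cotWeight, cotWeight, if_neg hr', if_neg (by omega), sub_zero, zero_mul]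
  simp only [hparts]
  refine tendsto_tsum_of_dominated_convergence (summable_sqrt_bound (Real.pi / 4 * C))
    (fun r => ?_) ?_
  · exact ((tendsto_cotWeight hl r).sub (tendsto_cotWeight hl (r + 1))).mul
      (tendsto_finsetSum _ fun k _ => hz k)
  · filter_upwards [hbound] with n hn r
    rw [norm_mul, Real.norm_eq_abs, Real.norm_eq_abs]
    by_cases hr : r < q n / 2
    · have h1 := hn (r + 1) (by omega)
      calc |cotWeight n r - cotWeight n (r + 1)| * |∑ k ∈ Finset.range (r + 1), h n k|
          ≤ (Real.pi / 4 * (1 / ((r + 1 : ℕ) : ℝ) ^ 2)) * (C * Real.sqrt (r + 1 : ℕ)) := by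
            have := Real.pi_pos
            gcongr
            exact abs_cotWeight_sub_le n r
        _ = _ := by ring
    · rw [cotWeight, cotWeight, if_neg hr, if_neg (by omega), sub_zero, abs_zero, zero_mul]
      have := Real.pi_pos
      positivity

/-! ### Limits of perturbed Birkhoff sums -/

/-- The limit of the normalised hitting times. -/
noncomputable def limitHit (i : ℤ) : ℝ := Int.fract (-i * α)

open Classical in
/-- The limit of the normalised hitting times that are counted by `A`. -/
noncomputable def cutLimit (A : Set ℤ) (i : ℤ) : ℝ := if i ∈ A then limitHit i else 0

/-- The limit of the perturbed Birkhoff sums, for the perturbation size `t` and the set `A` of grid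
points that are counted. -/
noncomputable def limitSum (t : ℝ) (A : Set ℤ) : ℝ :=
  ∑' r : ℕ, (2 * Real.log (1 + cutLimit A (r + 1) * t / (r + 1))
      - 2 * (cutLimit A (r + 1) * t / (r + 1)))
    + ∑' r : ℕ, (2 * Real.log (1 + -(cutLimit A (-(r + 1)) * t) / (r + 1))
      - 2 * (-(cutLimit A (-(r + 1)) * t) / (r + 1)))
    + 2 * Real.pi * (t * ∑' r : ℕ, (1 / (Real.pi * (r + 1 : ℕ)) - 1 / (Real.pi * (r + 1 + 1 : ℕ)))
        * ∑ k ∈ Finset.range (r + 1), (cutLimit A (k + 1) - cutLimit A (-(k + 1))))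

lemma cutLimit_nonneg (A : Set ℤ) (i : ℤ) : 0 ≤ cutLimit A i := by
  unfold cutLimit
  split_ifs
  · exact Int.fract_nonneg _
  · exact le_rfl

lemma cutLimit_le_one (A : Set ℤ) (i : ℤ) : cutLimit A i ≤ 1 := by
  unfold cutLimit
  split_ifs
  · exact (Int.fract_lt_one _).le
  · exact zero_le_one

lemma eventually_floor_conv {i : ℤ} (hi : i ≠ 0) :
    ∀ᶠ n in atTop, ⌊-i * conv n⌋ = ⌊-i * α⌋ := by
  have h1 : (⌊-i * α⌋ : ℝ) < -i * α := by
    refine lt_of_le_of_ne (Int.floor_le _) fun h => ?_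
    have := int_mul_α_ne (neg_ne_zero.2 hi) ⌊-i * α⌋
    push_cast at this
    exact this h.symm
  have h2 := Int.lt_floor_add_one (-i * α)
  have h3 : Tendsto (fun n => -i * conv n) atTop (𝓝 (-i * α)) := tendsto_conv.const_mul _
  filter_upwards [h3.eventually_const_lt h1, h3.eventually_lt_const h2] with n hn1 hn2
  rw [Int.floor_eq_iff]
  exact ⟨hn1.le, hn2⟩

lemma tendsto_hit_div_q {i : ℤ} (hi : i ≠ 0) :
    Tendsto (fun n => (hit n i : ℝ) / q n) atTop (𝓝 (limitHit i)) := by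
  have h3 : Tendsto (fun n => -i * conv n - ⌊-i * α⌋) atTop (𝓝 (limitHit i)) :=
    (tendsto_conv.const_mul (-(i : ℝ))).sub_const _
  refine h3.congr' ?_
  filter_upwards [eventually_floor_conv hi] with n hn
  rw [hit_div_q, Int.fract, hn]

lemma tendsto_cutHit (hl : l ≤ atTop) {m : ℕ → ℕ} {A : Set ℤ} {i : ℤ} (hi : i ≠ 0)
    (hA : ∀ᶠ n in l, (hit n i ≤ m n ↔ i ∈ A)) :
    Tendsto (fun n => cutHit n (m n) i) l (𝓝 (cutLimit A i)) := by
  by_cases h : i ∈ A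
  · rw [cutLimit, if_pos h]
    refine ((tendsto_hit_div_q hi).mono_left hl).congr' ?_
    filter_upwards [hA] with n hn
    rw [cutHit, if_pos (hn.2 h)]
  · rw [cutLimit, if_neg h]
    refine tendsto_const_nhds.congr' ?_
    filter_upwards [hA] with n hn
    rw [cutHit, if_neg (fun h' => h (hn.1 h'))]

lemma birkhoff_perturb_eq (n m : ℕ) (hm : m < q n) (d : ℝ) :
    birkhoff logKernel m (conv n + (-1) ^ n * d) - birkhoff logKernel m (conv n)
      = ∑ r ∈ Finset.range (q n / 2), gridRem (q n) (r + 1) (cutHit n m (r + 1) * (q n * d))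
        + ∑ r ∈ Finset.range ((q n - 1) / 2),
          gridRem (q n) (r + 1) (-(cutHit n m (-(r + 1)) * (q n * d)))
        + 2 * Real.pi * (d * q n ^ 2 * ∑ r ∈ Finset.range (q n / 2),
          Real.cot (Real.pi * (((r + 1 : ℕ) : ℝ) / q n)) / q n
            * (cutHit n m (r + 1) - cutHit n m (-(r + 1)))) := by
  have hq := q_cast_ne n
  set G : ℝ → ℝ := fun k => logKernel (k * (conv n + (-1) ^ n * d)) - logKernel (k * conv n)
  have hG : ∀ i : ℤ, (if hit n i ≤ m then G (hit n i) else 0)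
      = logKernel (i / q n + cutHit n m i * (q n * d)) - logKernel (i / q n) := by
    intro i
    have h0 := logKernel_hit_mul n i 0
    simp only [mul_zero, add_zero] at h0
    unfold cutHit
    split_ifs
    · simp only [G]
      rw [logKernel_hit_mul, h0]
      congr 3
      field_simp
    · simp
  have hsum : birkhoff logKernel m (conv n + (-1) ^ n * d) - birkhoff logKernel m (conv n)
      = ∑ k ∈ Finset.Icc 1 m, G k := by
    rw [birkhoff, birkhoff, ← Finset.sum_sub_distrib]
  rw [hsum, sum_Icc_eq_sum_hit n m hm G]
  simp only [hG]
  set c : ℕ → ℝ := fun r => Real.cot (Real.pi * (((r + 1 : ℕ) : ℝ) / q n)) / q n with hc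
  have hpos : ∀ r : ℕ, logKernel (((r + 1 : ℤ) : ℝ) / q n + cutHit n m (r + 1) * (q n * d))
        - logKernel (((r + 1 : ℤ) : ℝ) / q n)
      = gridRem (q n) (r + 1) (cutHit n m (r + 1) * (q n * d))
        + 2 * Real.pi * (d * q n ^ 2 * (c r * cutHit n m (r + 1))) := by
    intro r
    simp only [gridRem, hc]
    push_cast
    field_simp
    ring
  have hneg : ∀ r : ℕ, logKernel (((-(r + 1) : ℤ) : ℝ) / q n + cutHit n m (-(r + 1)) * (q n * d))
        - logKernel (((-(r + 1) : ℤ) : ℝ) / q n)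
      = gridRem (q n) (r + 1) (-(cutHit n m (-(r + 1)) * (q n * d)))
        - 2 * Real.pi * (d * q n ^ 2 * (c r * cutHit n m (-(r + 1)))) := by
    intro r
    rw [← logKernel_neg, ← logKernel_neg (((-(r + 1) : ℤ) : ℝ) / q n)]
    simp only [gridRem, hc]
    push_cast
    rw [show -(-((r : ℝ) + 1) / q n + cutHit n m (-(r + 1)) * (q n * d))
        = (r + 1) / q n + -(cutHit n m (-(r + 1)) * (q n * d)) by ring,
      show -(-((r : ℝ) + 1) / q n) = (r + 1) / q n by ring]
    field_simp
    ring
  -- The halves have different lengths only for even `q n`, and then the extra midpoint has weight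
  -- cot(π/2) = 0.
  have hext : ∑ r ∈ Finset.range ((q n - 1) / 2), c r * cutHit n m (-(r + 1))
      = ∑ r ∈ Finset.range (q n / 2), c r * cutHit n m (-(r + 1)) := by
    refine Finset.sum_subset (Finset.range_subset_range.2 (by omega)) fun r hr hr' => ?_
    rw [Finset.mem_range] at hr hr'
    have h1 : q n = 2 * (r + 1) := by omega
    have h2 : Real.pi * (((r + 1 : ℕ) : ℝ) / q n) = Real.pi / 2 := by
      rw [h1]; push_cast; field_simp
    simp only [hc]
    rw [h2, Real.cot_eq_cos_div_sin, Real.cos_pi_div_two]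
    simp
  simp only [hpos, hneg, mul_sub, Finset.sum_add_distrib, Finset.sum_sub_distrib,
    ← Finset.mul_sum, hext]
  ring

theorem tendsto_birkhoff_perturb (hl : l ≤ atTop) {m : ℕ → ℕ} {d : ℕ → ℝ} {t : ℝ} {A : Set ℤ}
    (hm : ∀ᶠ n in l, m n < q n) (hd0 : ∀ n, 0 ≤ d n)
    (hd : Tendsto (fun n => d n * (q n : ℝ) ^ 2) l (𝓝 t)) (ht0 : 0 ≤ t) (ht : t < 1)
    (hA : ∀ i : ℤ, i ≠ 0 → ∀ᶠ n in l, (hit n i ≤ m n ↔ i ∈ A)) :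
    Tendsto (fun n => birkhoff logKernel (m n) (conv n + (-1) ^ n * d n)
      - birkhoff logKernel (m n) (conv n)) l (𝓝 (limitSum t A)) := by
  have hcut : ∀ i : ℤ, i ≠ 0 → Tendsto (fun n => cutHit n (m n) i) l (𝓝 (cutLimit A i)) :=
    fun i hi => tendsto_cutHit hl hi (hA i hi)
  have hsize : ∀ᶠ n in l, ∀ i : ℤ, |cutHit n (m n) i * (q n * d n)| ≤ (1 + t) / 2 / q n := by
    filter_upwards [hd.eventually_lt_const (show t < (1 + t) / 2 by linarith)] with n hn i
    have hq := q_cast_pos n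
    have h0 := cutHit_nonneg n (m n) i
    have h1 := cutHit_le_one n (m n) i
    have h2 : 0 ≤ q n * d n := mul_nonneg hq.le (hd0 n)
    rw [abs_of_nonneg (mul_nonneg h0 h2), le_div_iff₀ hq]
    calc cutHit n (m n) i * (q n * d n) * q n ≤ 1 * (q n * d n) * q n := by gcongr
      _ = d n * (q n : ℝ) ^ 2 := by ring
      _ ≤ _ := hn.le
  have hlim : ∀ i : ℤ, i ≠ 0 → Tendsto (fun n => q n * (cutHit n (m n) i * (q n * d n))) l
      (𝓝 (cutLimit A i * t)) := fun i hi =>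
    ((hcut i hi).mul hd).congr fun n => by ring
  have hposne : ∀ r : ℕ, (r + 1 : ℤ) ≠ 0 := fun r => by omega
  have hnegne : ∀ r : ℕ, (-(r + 1) : ℤ) ≠ 0 := fun r => by omega
  have hmul : ∀ i, 0 ≤ cutLimit A i * t ∧ cutLimit A i * t < 1 := fun i =>
    ⟨mul_nonneg (cutLimit_nonneg A i) ht0,
      (mul_le_of_le_one_left ht0 (cutLimit_le_one A i)).trans_lt ht⟩
  have h1 := tendsto_sum_gridRem hl (tendsto_q_half hl) (fun n => by omega)
    (show 0 ≤ (1 + t) / 2 by linarith) (show (1 + t) / 2 < 1 by linarith)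
    (s := fun n r => cutHit n (m n) (r + 1) * (q n * d n))
    (hsize.mono fun n hn r => hn (r + 1)) (fun r => hlim _ (hposne r))
    (fun r => by linarith [(hmul (r + 1)).1])
  have h2 := tendsto_sum_gridRem hl (tendsto_q_sub_one_half hl) (fun n => by omega)
    (show 0 ≤ (1 + t) / 2 by linarith) (show (1 + t) / 2 < 1 by linarith)
    (s := fun n r => -(cutHit n (m n) (-(r + 1)) * (q n * d n)))
    (hsize.mono fun n hn r => by rw [abs_neg]; exact hn (-(r + 1)))
    (fun r => by simpa only [mul_neg] using (hlim _ (hnegne r)).neg)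
    (fun r => by linarith [(hmul (-(r + 1))).2])
  have h3 := tendsto_linear_part hl (C := 20) (by norm_num)
    (h := fun n r => cutHit n (m n) (r + 1) - cutHit n (m n) (-(r + 1)))
    (fun r => (hcut _ (hposne r)).sub (hcut _ (hnegne r)))
    (hm.mono fun n hn N hN => abs_sum_cutHit_sub_le n (m n) N hN hn)
  refine ((h1.add h2).add ((hd.mul h3).const_mul (2 * Real.pi))).congr' ?_
  filter_upwards [hm] with n hn
  exact (birkhoff_perturb_eq n (m n) hn (d n)).symm

/-! ### Rotation numbers between consecutive convergents -/

lemma one_div_q_le_fract {n k : ℕ} (hk : 1 ≤ k) (hkn : k < q n) :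
    1 / (q n : ℝ) ≤ Int.fract (k * conv n) ∧ Int.fract (k * conv n) ≤ 1 - 1 / q n := by
  have hq := q_cast_pos n
  have h : Int.fract (k * conv n) = ((k * p n % q n : ℕ) : ℝ) / q n := by
    rw [← Int.fract_div_natCast_eq_div_natCast_mod]
    congr 1
    unfold conv
    push_cast
    ring
  have h1 : 1 ≤ k * p n % q n := by
    rw [Nat.one_le_iff_ne_zero]
    intro h0
    have h2 : q n ∣ k := (coprime_p_q n).symm.dvd_of_dvd_mul_right (Nat.dvd_of_mod_eq_zero h0)
    have := Nat.le_of_dvd (by omega) h2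
    omega
  have h2 : k * p n % q n + 1 ≤ q n := Nat.mod_lt _ (q_pos n)
  have h1' : (1 : ℝ) ≤ (k * p n % q n : ℕ) := by exact_mod_cast h1
  have h2' : ((k * p n % q n : ℕ) : ℝ) + 1 ≤ q n := by exact_mod_cast h2
  rw [h, one_sub_div hq.ne']
  constructor <;> gcongr
  linarith

/-- The point k p_n/q_n keeps distance 1/q_n from the integers, while the perturbation moves it by
less than 1/q_{n+1}. Hence no pole is crossed between consecutive convergents. -/
lemma mul_add_mem_Ioo {n k : ℕ} (hk : 1 ≤ k) (hkn : k < q n) {e : ℝ} (he0 : 0 ≤ e)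
    (he1 : e ≤ 1 / (q n * q (n + 1))) :
    (k * (conv n + (-1) ^ n * e) : ℝ) ∈ Ioo (⌊k * conv n⌋ : ℝ) (⌊k * conv n⌋ + 1) := by
  have hq := q_cast_pos n
  have hq' := q_cast_pos (n + 1)
  obtain ⟨h1, h2⟩ := one_div_q_le_fract hk hkn
  have hk' : (k : ℝ) < q n := by exact_mod_cast hkn
  have hqq : (q n : ℝ) ≤ q (n + 1) := by exact_mod_cast q_mono (Nat.le_succ n)
  have h3 : |(-1 : ℝ) ^ n * (k * e)| < 1 / q n := by
    rw [abs_mul, abs_pow, abs_neg, abs_one, one_pow, one_mul,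
      abs_of_nonneg (mul_nonneg (Nat.cast_nonneg k) he0)]
    calc (k : ℝ) * e ≤ k * (1 / (q n * q (n + 1))) := by gcongr
      _ < q n * (1 / (q n * q (n + 1))) := by gcongr
      _ = 1 / q (n + 1) := by field_simp
      _ ≤ 1 / q n := by gcongr
  obtain ⟨h4, h5⟩ := abs_lt.1 h3
  have h6 : (k * (conv n + (-1) ^ n * e) : ℝ)
      = ⌊k * conv n⌋ + Int.fract (k * conv n) + (-1) ^ n * (k * e) := by
    rw [Int.floor_add_fract]; ring
  rw [h6]
  constructor <;> linarith

lemma conv_succ_size (n : ℕ) : (0 : ℝ) ≤ 1 / (q n * q (n + 1)) := by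
  positivity

/-! ### The sawtooth -/

lemma diff_sawtooth_eq (n : ℕ) {x : ℝ} (hx : x ∈ Ico (0 : ℝ) 1) :
    diff sawtooth n x = (-1) ^ n * (Real.pi * (q n / q (n + 1))
      * ((⌊x * q n⌋₊ / q n) * (⌊x * q n⌋₊ / q n + 1 / q n))) := by
  have hq := q_cast_pos n
  have hq' := q_cast_pos (n + 1)
  have hm : ⌊x * q n⌋₊ < q n := by
    rw [Nat.floor_lt (mul_nonneg hx.1 hq.le)]
    exact mul_lt_of_lt_one_left hq hx.2
  set m := ⌊x * (q n : ℝ)⌋₊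
  have hterm : ∀ k ∈ Finset.Icc 1 m, sawtooth (k * conv (n + 1)) - sawtooth (k * conv n)
      = (-1) ^ n * (2 * Real.pi / (q n * q (n + 1))) * k := by
    intro k hk
    rw [Finset.mem_Icc] at hk
    have h := mul_add_mem_Ioo hk.1 (hk.2.trans_lt hm) (conv_succ_size n) le_rfl
    rw [← conv_succ] at h
    have hfl : ⌊k * conv (n + 1)⌋ = ⌊k * conv n⌋ := Int.floor_eq_iff.2 ⟨h.1.le, h.2⟩
    simp only [sawtooth, Int.fract, hfl]
    rw [conv_succ]
    field_simp
    ring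
  have hsum : ∑ k ∈ Finset.Icc 1 m, (k : ℝ) = m * (m + 1) / 2 := by
    have h := Finset.sum_range_id_mul_two (m + 1)
    rw [sum_Icc_one]
    have h2 : ∑ j ∈ Finset.range m, ((j + 1 : ℕ) : ℝ) = ((∑ i ∈ Finset.range (m + 1), i : ℕ) : ℝ) := by
      rw [Finset.sum_range_succ']; push_cast; simp
    rw [h2, eq_div_iff two_ne_zero]
    have h3 : (((∑ i ∈ Finset.range (m + 1), i) * 2 : ℕ) : ℝ) = (((m + 1) * (m + 1 - 1) : ℕ) : ℝ) := by
      rw [h]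
    push_cast at h3 ⊢
    linarith
  have : diff sawtooth n x = ∑ k ∈ Finset.Icc 1 m,
      (sawtooth (k * conv (n + 1)) - sawtooth (k * conv n)) := by
    rw [Finset.sum_sub_distrib]; rfl
  rw [this, Finset.sum_congr rfl hterm, ← Finset.mul_sum, hsum]
  field_simp

lemma c_eq : c = Real.pi * α := by
  have h5 : (0 : ℝ) < 2 * α + 1 := by linarith [α_pos]
  rw [c, sqrt_five_eq, div_eq_iff h5.ne']
  linear_combination -Real.pi * α_sq

lemma tendsto_floor_div {x : ℝ} (hx : 0 ≤ x) :
    Tendsto (fun n => (⌊x * q n⌋₊ : ℝ) / q n) atTop (𝓝 x) :=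
  (tendsto_nat_floor_mul_div_atTop hx).comp tendsto_q

lemma tendsto_diff_sawtooth {x ε : ℝ} (hl : l ≤ atTop) (hε : ∀ᶠ n in l, (-1 : ℝ) ^ n = ε)
    (hx : x ∈ Ico (0 : ℝ) 1) :
    Tendsto (fun n => diff sawtooth n x) l (𝓝 (ε * (c * x ^ 2))) := by
  have h1 := tendsto_floor_div hx.1
  have h2 : Tendsto (fun n => 1 / (q n : ℝ)) atTop (𝓝 0) := tendsto_const_nhds.div_atTop tendsto_q
  have h3 := (tendsto_q_div_q_succ.const_mul Real.pi).mul (h1.mul (h1.add h2))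
  have h4 := (h3.mono_left hl).const_mul ε
  rw [add_zero, ← c_eq, ← sq] at h4
  refine h4.congr' ?_
  filter_upwards [hε] with n hn
  rw [diff_sawtooth_eq n hx, hn]

/-! ### The difference functions of the logarithmic kernel -/

/-- The grid points counted up to `x`, for the parity given by the sign `ε`. -/
def hitSet (ε x : ℝ) : Set ℤ := {i | limitHit i < x ∨ (limitHit i = x ∧ ε * i < 0)}

/-- The limit of the difference functions along the indices of parity `ε`. -/
noncomputable def diffLimit (ε x : ℝ) : ℝ := limitSum α (hitSet ε x)

lemma hitSet_congr {x : ℝ} (hx : x ∉ orbitPoints) (ε ε' : ℝ) : hitSet ε x = hitSet ε' x := by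
  have : ∀ (η : ℝ) (i : ℤ), ¬ (limitHit i = x ∧ η * i < 0) := by
    rintro η i ⟨h1, h2⟩
    refine hx ⟨-i, ?_, ?_⟩
    · rintro h0
      rw [neg_eq_zero.1 h0] at h2
      simp at h2
    · rw [← h1, limitHit]; push_cast; rfl
  ext i
  simp only [hitSet, mem_ofPred_eq, this, or_false]

lemma hit_le_floor_iff (n : ℕ) (i : ℤ) {y : ℝ} (hy : 0 ≤ y) : hit n i ≤ ⌊y⌋₊ ↔ (hit n i : ℝ) ≤ y := by
  have h := hit_nonneg n i
  obtain ⟨k, hk⟩ := Int.eq_ofNat_of_zero_le h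
  rw [hk]
  have := Nat.le_floor_iff (n := k) hy
  push_cast
  exact_mod_cast this

/-- Comparison of hitting times with a moving threshold. -/
lemma eventually_hit_le_iff (hl : l ≤ atTop) {i : ℤ} (hi : i ≠ 0) {ε x : ℝ} {v : ℕ → ℝ}
    (hv : Tendsto v l (𝓝 x))
    (htie : limitHit i = x → ∀ᶠ n in l, ((hit n i : ℝ) / q n ≤ v n ↔ ε * i < 0)) :
    ∀ᶠ n in l, ((hit n i : ℝ) / q n ≤ v n ↔ i ∈ hitSet ε x) := by
  have h := (tendsto_hit_div_q hi).mono_left hl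
  rcases lt_trichotomy (limitHit i) x with hlt | heq | hgt
  · have hmem : i ∈ hitSet ε x := Or.inl hlt
    filter_upwards [h.eventually_lt hv hlt] with n hn
    exact ⟨fun _ => hmem, fun _ => hn.le⟩
  · filter_upwards [htie heq] with n hn
    rw [hn]
    simp [hitSet, heq]
  · have hmem : i ∉ hitSet ε x := by
      rintro (h | ⟨h, -⟩) <;> linarith
    filter_upwards [hv.eventually_lt h hgt] with n hn
    exact ⟨fun h' => absurd h' (not_le.2 hn), fun h' => absurd h' hmem⟩

lemma α_sub_conv_sign {n : ℕ} {ε : ℝ} (hn : (-1 : ℝ) ^ n = ε) : 0 < ε * (α - conv n) := by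
  rw [← hn]; exact neg_one_pow_mul_α_sub_conv_pos n

lemma mul_nonpos_iff_of_sign {ε a b : ℝ} (hε : ε = 1 ∨ ε = -1) (ha : a ≠ 0) (hb : 0 < ε * b) :
    a * b ≤ 0 ↔ ε * a < 0 := by
  rcases hε with rfl | rfl
  · constructor
    · intro h
      rcases lt_or_gt_of_ne ha with h' | h'
      · linarith
      · nlinarith
    · intro h; nlinarith
  · constructor
    · intro h
      rcases lt_or_gt_of_ne ha with h' | h'
      · nlinarith
      · linarith
    · intro h; nlinarith

/-- Once the floors for `conv n` and α agree, the comparison becomes i(α - `conv n`) ≤ 0, and the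
sign of α - `conv n` is the parity sign. -/
lemma eventually_hit_tie {i : ℤ} (hi : i ≠ 0) {ε x : ℝ} (hl : l ≤ atTop) (hε : ε = 1 ∨ ε = -1)
    (hpar : ∀ᶠ n in l, (-1 : ℝ) ^ n = ε) (hx : limitHit i = x) :
    ∀ᶠ n in l, ((hit n i : ℝ) / q n ≤ x ↔ ε * i < 0) := by
  filter_upwards [hpar, hl (eventually_floor_conv hi)] with n h1 h2
  have h3 := α_sub_conv_sign h1
  rw [← mul_nonpos_iff_of_sign hε (by exact_mod_cast hi) h3, ← hx, hit_div_q, limitHit, Int.fract,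
    Int.fract, h2]
  constructor <;> intro h <;> linarith

lemma floor_mul_q_lt (n : ℕ) {x : ℝ} (hx : x ∈ Ico (0 : ℝ) 1) : ⌊x * q n⌋₊ < q n := by
  rw [Nat.floor_lt (mul_nonneg hx.1 (q_cast_pos n).le)]
  exact mul_lt_of_lt_one_left (q_cast_pos n) hx.2

lemma tendsto_conv_succ_size (hl : l ≤ atTop) :
    Tendsto (fun n => 1 / (q n * q (n + 1) : ℝ) * (q n : ℝ) ^ 2) l (𝓝 α) := by
  refine (tendsto_q_div_q_succ.mono_left hl).congr fun n => ?_
  have h1 := q_cast_ne n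
  have h2 := q_cast_ne (n + 1)
  field_simp

theorem tendsto_diff_logKernel {x ε : ℝ} (hl : l ≤ atTop) (hε : ε = 1 ∨ ε = -1)
    (hpar : x ∉ orbitPoints ∨ ∀ᶠ n in l, (-1 : ℝ) ^ n = ε) (hx : x ∈ Ico (0 : ℝ) 1) :
    Tendsto (fun n => diff logKernel n x) l (𝓝 (diffLimit ε x)) := by
  have h := tendsto_birkhoff_perturb (m := fun n => ⌊x * q n⌋₊) (A := hitSet ε x) hl
    (Eventually.of_forall fun n => floor_mul_q_lt n hx)
    conv_succ_size (tendsto_conv_succ_size hl) α_pos.le α_lt_one fun i hi => ?_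
  · refine h.congr fun n => ?_
    rw [← conv_succ]; rfl
  · have h1 := eventually_hit_le_iff (ε := ε) hl hi (tendsto_const_nhds (x := x)) fun heq => ?_
    · filter_upwards [h1] with n hn
      rw [← hn, hit_le_floor_iff n i (mul_nonneg hx.1 (q_cast_pos n).le), div_le_iff₀ (q_cast_pos n)]
    · rcases hpar with hpar | hpar
      · refine absurd ⟨-i, neg_ne_zero.2 hi, ?_⟩ hpar
        rw [← heq, limitHit]; push_cast; rfl
      · exact eventually_hit_tie hi hl hε hpar heq

/-! ### The complex kernel -/

lemma diff_complexKernel_eq (n : ℕ) {x : ℝ} (hx : x ∈ Ico (0 : ℝ) 1) :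
    diff complexKernel n x = ((diff logKernel n x : ℝ) : ℂ)
      + ((diff sawtooth n x : ℝ) : ℂ) * Complex.I := by
  have hm := floor_mul_q_lt n hx
  have key : ∀ N, ⌊x * (q n : ℝ)⌋₊ < q N →
      birkhoff complexKernel ⌊x * (q n : ℝ)⌋₊ (conv N)
        = ((birkhoff logKernel ⌊x * (q n : ℝ)⌋₊ (conv N) : ℝ) : ℂ)
          + ((birkhoff sawtooth ⌊x * (q n : ℝ)⌋₊ (conv N) : ℝ) : ℂ) * Complex.I := by
    intro N hN
    simp only [birkhoff]
    push_cast
    rw [Finset.sum_mul, ← Finset.sum_add_distrib]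
    refine Finset.sum_congr rfl fun k hk => ?_
    rw [Finset.mem_Icc] at hk
    have h := (one_div_q_le_fract hk.1 (hk.2.trans_lt hN)).1
    have hq := q_cast_pos N
    exact complexKernel_eq _ (lt_of_lt_of_le (by positivity) h).ne'
  have h1 := key n hm
  have h2 := key (n + 1) (hm.trans_le (q_mono (Nat.le_succ n)))
  unfold conv at h1 h2
  simp only [diff]
  rw [h1, h2]
  push_cast
  ring

lemma tendsto_diff_complexKernel {x ε : ℝ} (hl : l ≤ atTop) (hε : ε = 1 ∨ ε = -1)
    (hpar : ∀ᶠ n in l, (-1 : ℝ) ^ n = ε) (hx : x ∈ Ico (0 : ℝ) 1) :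
    Tendsto (fun n => diff complexKernel n x) l
      (𝓝 ((diffLimit ε x : ℂ) + ((ε * (c * x ^ 2) : ℝ) : ℂ) * Complex.I)) := by
  have h1 := (Complex.continuous_ofReal.tendsto _).comp
    (tendsto_diff_logKernel hl hε (Or.inr hpar) hx)
  have h2 := ((Complex.continuous_ofReal.tendsto _).comp
    (tendsto_diff_sawtooth hl hpar hx)).mul_const Complex.I
  exact (h1.add h2).congr fun n => (diff_complexKernel_eq n hx).symm

/-! ### Concavity in the rotation number and monotonicity -/

lemma concaveOn_logKernel_mul {n k : ℕ} (hk : 1 ≤ k) (hkn : k < q n) :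
    ConcaveOn ℝ (Icc (0 : ℝ) (1 / (q n * q (n + 1))))
      (fun e => logKernel (k * (conv n + (-1) ^ n * e))) := by
  refine ⟨convex_Icc _ _, fun x hx y hy a b ha hb hab => ?_⟩
  have h := (concaveOn_logKernel_int ⌊k * conv n⌋).2 (mul_add_mem_Ioo hk hkn hx.1 hx.2)
    (mul_add_mem_Ioo hk hkn hy.1 hy.2) ha hb hab
  refine h.trans_eq ?_
  congr 1
  simp only [smul_eq_mul]
  linear_combination (k : ℝ) * conv n * hab

lemma concaveOn_birkhoff {n m : ℕ} (hm : m < q n) :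
    ConcaveOn ℝ (Icc (0 : ℝ) (1 / (q n * q (n + 1))))
      (fun e => birkhoff logKernel m (conv n + (-1) ^ n * e)) := by
  refine ⟨convex_Icc _ _, fun x hx y hy a b ha hb hab => ?_⟩
  simp only [birkhoff, smul_eq_mul, Finset.mul_sum]
  rw [← Finset.sum_add_distrib]
  refine Finset.sum_le_sum fun k hk => ?_
  rw [Finset.mem_Icc] at hk
  exact (concaveOn_logKernel_mul hk.1 (hk.2.trans_lt hm)).2 hx hy ha hb hab

lemma one_div_size_add_two_mem (n : ℕ) :
    (1 / (q n * q (n + 2)) : ℝ) ∈ Icc (0 : ℝ) (1 / (q n * q (n + 1))) := by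
  have h1 := q_cast_pos n
  have h2 := q_cast_pos (n + 1)
  have h3 : (q (n + 1) : ℝ) ≤ q (n + 2) := by exact_mod_cast q_mono (Nat.le_succ _)
  refine ⟨by positivity, ?_⟩
  gcongr

/-- The combination of two consecutive differences that has nonnegative increments. -/
noncomputable def pairSum (n m : ℕ) : ℝ :=
  (birkhoff logKernel m (conv (n + 2)) - birkhoff logKernel m (conv (n + 1)))
    + q n / q (n + 2) * (birkhoff logKernel m (conv (n + 1)) - birkhoff logKernel m (conv n))

/-- The increment is g(kβ_{n+2}) minus the average of g(kβ_n) and g(kβ_{n+1}) with weights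
q_n/q_{n+2} and q_{n+1}/q_{n+2}, where β_j = `conv j` and k = m + 1. These weights express β_{n+2}
as the mediant, so concavity applies. -/
lemma pairSum_le_succ {n m : ℕ} (hm : m + 1 < q n) : pairSum n m ≤ pairSum n (m + 1) := by
  have hq := q_cast_pos n
  have hq1 := q_cast_pos (n + 1)
  have hq2 := q_cast_pos (n + 2)
  have hadd : (q (n + 2) : ℝ) = q n + q (n + 1) := by exact_mod_cast q_add_two n
  have h := (concaveOn_logKernel_mul (k := m + 1) (by omega) hm).2
    (show (0 : ℝ) ∈ Icc (0 : ℝ) (1 / (q n * q (n + 1))) from ⟨le_rfl, by positivity⟩)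
    (show (1 / (q n * q (n + 1)) : ℝ) ∈ Icc (0 : ℝ) (1 / (q n * q (n + 1))) from
      ⟨by positivity, le_rfl⟩)
    (show (0 : ℝ) ≤ q n / q (n + 2) by positivity)
    (show (0 : ℝ) ≤ q (n + 1) / q (n + 2) by positivity)
    (by rw [← add_div, ← hadd, div_self hq2.ne'])
  have he : q (n + 1) / q (n + 2) * (1 / (q n * q (n + 1)) : ℝ) = 1 / (q n * q (n + 2)) := by
    field_simp
  simp only [smul_eq_mul, mul_zero, zero_add, add_zero] at h
  rw [he, ← conv_succ, ← conv_add_two] at h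
  have hw : (q (n + 1) / q (n + 2) : ℝ) = 1 - q n / q (n + 2) := by
    rw [eq_sub_iff_add_eq, ← add_div, add_comm, ← hadd, div_self hq2.ne']
  rw [hw] at h
  have hs : ∀ β, birkhoff logKernel (m + 1) β
      = birkhoff logKernel m β + logKernel ((m + 1 : ℕ) * β) := fun β =>
    Finset.sum_Icc_succ_top (by omega) _
  simp only [pairSum, hs]
  linarith

lemma pairSum_mono {n m m' : ℕ} (h : m ≤ m') (hm : m' < q n) : pairSum n m ≤ pairSum n m' := by
  induction m', h using Nat.le_induction with
  | base => exact le_rfl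
  | succ k _ ih => exact (ih (by omega)).trans (pairSum_le_succ hm)

lemma tendsto_succ_map (hl : l ≤ atTop) : l.map (· + 1) ≤ atTop :=
  (tendsto_add_atTop_nat 1).mono_left hl

/-- Relative to q_{n+1}, the cut-off x q_n sits at x q_n/q_{n+1} → αx. It is a moving threshold and
not αx itself, so the ties have to be settled anew; the index shift by one flips the parity sign. -/
lemma tendsto_pairSum {x ε : ℝ} (hl : l ≤ atTop) (hε : ε = 1 ∨ ε = -1)
    (hpar : ∀ᶠ n in l, (-1 : ℝ) ^ n = ε) (hx : x ∈ Ico (0 : ℝ) 1) :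
    Tendsto (fun n => pairSum n ⌊x * q n⌋₊) l
      (𝓝 (diffLimit (-ε) (α * x) + α ^ 2 * diffLimit ε x)) := by
  have h2 : Tendsto (fun n => q n / q (n + 2) * diff logKernel n x) l
      (𝓝 (α ^ 2 * diffLimit ε x)) :=
    (tendsto_q_div_q_add_two.mono_left hl).mul (tendsto_diff_logKernel hl hε (Or.inr hpar) hx)
  have h1 : Tendsto (fun n => birkhoff logKernel ⌊x * q n⌋₊ (conv (n + 2))
      - birkhoff logKernel ⌊x * q n⌋₊ (conv (n + 1))) l (𝓝 (diffLimit (-ε) (α * x))) := by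
    have hl' := tendsto_succ_map hl
    have h := tendsto_birkhoff_perturb (m := fun N => ⌊x * q (N - 1)⌋₊)
      (A := hitSet (-ε) (α * x)) hl'
      (Eventually.of_forall fun N => (floor_mul_q_lt (N - 1) hx).trans_le (q_mono (Nat.sub_le N 1)))
      conv_succ_size (tendsto_conv_succ_size hl') α_pos.le α_lt_one fun i hi => ?_
    · rw [tendsto_map'_iff] at h
      refine h.congr fun n => ?_
      simp only [Function.comp, Nat.add_sub_cancel]
      rw [← conv_succ]
    · have hv : Tendsto (fun N => x * (q (N - 1) / q N)) (l.map (· + 1)) (𝓝 (α * x)) := by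
        rw [tendsto_map'_iff, mul_comm α]
        exact (tendsto_q_div_q_succ.mono_left hl).const_mul x
      have hiff := eventually_hit_le_iff (ε := -ε) hl' hi hv fun heq => ?_
      · filter_upwards [hiff] with N hN
        rw [← hN, hit_le_floor_iff N i (mul_nonneg hx.1 (q_cast_pos _).le), ← mul_div_assoc,
          div_le_div_iff_of_pos_right (q_cast_pos N)]
      · rw [eventually_map]
        have hfl := hl ((tendsto_add_atTop_nat 1).eventually (eventually_floor_conv hi))
        filter_upwards [hpar, hfl] with n hn hn2
        have hsign : 0 < -ε * (α - conv (n + 1)) :=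
          α_sub_conv_sign (by rw [pow_succ, hn]; ring)
        have hq := q_cast_pos (n + 1)
        have hα := α_pos
        have hxα : α * x = -i * α - ⌊-i * α⌋ := by rw [← heq, limitHit, Int.fract]
        -- With M = ⌊-iα⌋, M and -i have the same sign. The case M = 0 with i < 0 would force αx =
        -- -iα ≥ α, against x < 1.
        have hM : ((⌊-i * α⌋ : ℤ) : ℝ) * i < 0 := by
          have h1 := Int.floor_le (-i * α)
          have h2 := Int.lt_floor_add_one (-i * α)
          rcases lt_or_gt_of_ne hi with hneg | hpos
          · have hi1 : (i : ℝ) ≤ -1 := by exact_mod_cast (show i ≤ -1 by omega)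
            have hM0 : ⌊-i * α⌋ ≠ 0 := by
              intro h0
              rw [h0] at hxα
              push_cast at hxα
              nlinarith [hx.2]
            have hM1 : 0 ≤ ⌊-i * α⌋ := Int.floor_nonneg.2 (by nlinarith)
            have hM2 : (0 : ℝ) < ⌊-i * α⌋ := by exact_mod_cast lt_of_le_of_ne hM1 hM0.symm
            nlinarith
          · have hi1 : (1 : ℝ) ≤ i := by exact_mod_cast hpos
            have hM2 : (⌊-i * α⌋ : ℝ) < 0 := by nlinarith
            nlinarith
        have hMne : ((⌊-i * α⌋ : ℤ) : ℝ) ≠ 0 := fun h0 => by rw [h0] at hM; simp at hM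
        have hconv : (q n : ℝ) = conv (n + 1) * q (n + 1) := by
          rw [mul_comm, q_mul_conv, p_succ]
        -- After multiplication by α and substitution of αx = -iα - M, the terms in i cancel. The
        -- tie is now decided by the sign of -M instead of i, with the same outcome by `hM`.
        have hcmp : ((hit (n + 1) i : ℝ) / q (n + 1) ≤ x * (q (n + 1 - 1) / q (n + 1)))
            ↔ (⌊-i * α⌋ : ℝ) * (α - conv (n + 1)) * -1 ≤ 0 := by
          rw [hit_div_q, Int.fract, hn2, Nat.add_sub_cancel, hconv, mul_div_cancel_right₀ _ hq.ne',
            ← mul_le_mul_iff_right₀ hα]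
          have : α * (x * conv (n + 1)) = (-i * α - ⌊-i * α⌋) * conv (n + 1) := by
            rw [← hxα]; ring
          rw [this]
          constructor <;> intro h <;> linarith
        have hfin := mul_nonpos_iff_of_sign (ε := ε) hε hMne (b := -(α - conv (n + 1)))
          (by linarith)
        rw [hcmp, show (⌊-i * α⌋ : ℝ) * (α - conv (n + 1)) * -1
          = ⌊-i * α⌋ * -(α - conv (n + 1)) by ring, hfin]
        rcases hε with rfl | rfl
        · constructor
          · intro h; nlinarith
          · intro h; nlinarith
        · constructor
          · intro h; nlinarith
          · intro h; nlinarith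
  exact h1.add h2

theorem monotoneOn_diffLimit [l.NeBot] {ε : ℝ} (hl : l ≤ atTop) (hε : ε = 1 ∨ ε = -1)
    (hpar : ∀ᶠ n in l, (-1 : ℝ) ^ n = ε) :
    MonotoneOn (fun x => diffLimit (-ε) (α * x) + α ^ 2 * diffLimit ε x) (Ico (0 : ℝ) 1) := by
  intro x hx y hy hxy
  refine le_of_tendsto_of_tendsto' (tendsto_pairSum hl hε hpar hx) (tendsto_pairSum hl hε hpar hy)
    fun n => pairSum_mono (Nat.floor_le_floor ?_) (floor_mul_q_lt n hy)
  have := q_cast_pos n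
  gcongr

/-! ### The sums over a full period -/

lemma half_lt_α : 1 / 2 < α := by
  nlinarith [α_sq, α_pos]

lemma α_lt_two_thirds : α < 2 / 3 := by
  nlinarith [α_sq, α_pos]

lemma birkhoff_conv (n : ℕ) : birkhoff logKernel (q n - 1) (conv n) = 2 * Real.log (q n) :=
  birkhoff_logKernel_ratio (p n) (q n) (q_pos n) (coprime_p_q n)

/-- The effect on the full sum of moving the rotation number away from the convergent. -/
noncomputable def shift (n : ℕ) (d : ℝ) : ℝ :=
  birkhoff logKernel (q n - 1) (conv n + (-1) ^ n * d) - birkhoff logKernel (q n - 1) (conv n)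

lemma tendsto_shift {d : ℕ → ℝ} {t : ℝ} (hd0 : ∀ n, 0 ≤ d n)
    (hd : Tendsto (fun n => d n * (q n : ℝ) ^ 2) atTop (𝓝 t)) (ht0 : 0 ≤ t) (ht : t < 1) :
    Tendsto (fun n => shift n (d n)) atTop (𝓝 (limitSum t univ)) := by
  refine tendsto_birkhoff_perturb le_rfl
    (Eventually.of_forall fun n => Nat.sub_lt (q_pos n) one_pos) hd0 hd ht0 ht
    fun i _ => Eventually.of_forall fun n => ?_
  have h1 := hit_lt n i
  have h2 := q_pos n
  simp only [mem_univ, iff_true]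
  omega

lemma three_points_concave {s : Set ℝ} {f : ℝ → ℝ} (hf : ConcaveOn ℝ s f) {x y z : ℝ} (hx : x ∈ s)
    (hz : z ∈ s) (hxy : x < y) (hyz : y < z) :
    (z - y) * f x + (y - x) * f z ≤ (z - x) * f y := by
  have hzx : 0 < z - x := by linarith
  have h := hf.2 hx hz (show 0 ≤ (z - y) / (z - x) from div_nonneg (by linarith) hzx.le)
    (show 0 ≤ (y - x) / (z - x) from div_nonneg (by linarith) hzx.le)
    (by rw [← add_div, div_eq_one_iff_eq hzx.ne']; ring)
  simp only [smul_eq_mul] at h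
  rw [show (z - y) / (z - x) * x + (y - x) / (z - x) * z = y by field_simp; ring] at h
  have h2 := mul_le_mul_of_nonneg_left h hzx.le
  refine le_trans (le_of_eq ?_) h2
  field_simp

/-- Concavity in the rotation number survives the limit. The strict inequalities between the t's
ensure that the three perturbations are eventually ordered. -/
lemma limitSum_concave {d₁ d₂ d₃ : ℕ → ℝ} {t₁ t₂ t₃ : ℝ} (h0 : ∀ n, 0 ≤ d₁ n)
    (h0' : ∀ n, 0 ≤ d₂ n) (h3 : ∀ n, d₃ n ∈ Icc (0 : ℝ) (1 / (q n * q (n + 1))))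
    (h₁ : Tendsto (fun n => d₁ n * (q n : ℝ) ^ 2) atTop (𝓝 t₁))
    (h₂ : Tendsto (fun n => d₂ n * (q n : ℝ) ^ 2) atTop (𝓝 t₂))
    (h₃ : Tendsto (fun n => d₃ n * (q n : ℝ) ^ 2) atTop (𝓝 t₃))
    (ht₁ : 0 ≤ t₁) (h12 : t₁ < t₂) (h23 : t₂ < t₃) (ht₃ : t₃ < 1) :
    (t₃ - t₂) * limitSum t₁ univ + (t₂ - t₁) * limitSum t₃ univ
      ≤ (t₃ - t₁) * limitSum t₂ univ := by
  have l1 := tendsto_shift h0 h₁ ht₁ (by linarith)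
  have l2 := tendsto_shift h0' h₂ (by linarith) (by linarith)
  have l3 := tendsto_shift (fun n => (h3 n).1) h₃ (by linarith) ht₃
  refine le_of_tendsto_of_tendsto (((h₃.sub h₂).mul l1).add ((h₂.sub h₁).mul l3))
    ((h₃.sub h₁).mul l2) ?_
  filter_upwards [h₁.eventually_lt h₂ h12, h₂.eventually_lt h₃ h23] with n e1 e2
  have hq : 0 < (q n : ℝ) ^ 2 := pow_pos (q_cast_pos n) 2
  have e1' := lt_of_mul_lt_mul_right e1 hq.le
  have e2' := lt_of_mul_lt_mul_right e2 hq.le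
  have hc := three_points_concave (concaveOn_birkhoff (Nat.sub_lt (q_pos n) one_pos))
    ⟨h0 n, (e1'.trans e2').le.trans (h3 n).2⟩ (h3 n) e1' e2'
  have hc' := mul_le_mul_of_nonneg_left hc hq.le
  simp only [shift]
  linarith

lemma tendsto_size_add_two :
    Tendsto (fun n => 1 / (q n * q (n + 2) : ℝ) * (q n : ℝ) ^ 2) atTop (𝓝 (α ^ 2)) := by
  refine tendsto_q_div_q_add_two.congr fun n => ?_
  have h1 := q_cast_ne n
  have h2 := q_cast_ne (n + 2)
  field_simp

lemma tendsto_size_α :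
    Tendsto (fun n => α ^ (n + 1) / q n * (q n : ℝ) ^ 2) atTop (𝓝 (1 / Real.sqrt 5)) := by
  refine tendsto_α_pow_mul_q.congr fun n => ?_
  have h1 := q_cast_ne n
  field_simp

/-- Splitting the full sum for the fraction `p (n + 2) / q (n + 2)` by reflection. -/
lemma two_log_q_add_two (n : ℕ) :
    2 * Real.log (q (n + 2)) = birkhoff logKernel (q (n + 1) - 1) (conv (n + 2))
      + logKernel (1 / q (n + 2)) + birkhoff logKernel (q n - 1) (conv (n + 2)) := by
  have h1 := q_pos n
  have h2 := q_pos (n + 1)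
  have h3 := q_add_two n
  rw [← birkhoff_conv (n + 2)]
  simp only [birkhoff, sum_Icc_one]
  rw [show q (n + 2) - 1 = (q (n + 1) - 1 + 1) + (q n - 1) by omega, Finset.sum_range_add,
    Finset.sum_range_succ]
  congr 1
  · congr 1
    rw [show q (n + 1) - 1 + 1 = q (n + 1) by omega, conv_succ, mul_add, q_mul_conv, add_comm,
      show (p (n + 1) : ℝ) = ((p (n + 1) : ℤ) : ℝ) by push_cast; rfl, logKernel_add_int,
      mul_left_comm, logKernel_neg_one_pow_mul]
    congr 1
    have := q_cast_ne (n + 1)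
    field_simp
  · rw [← Finset.sum_range_reflect]
    refine Finset.sum_congr rfl fun j hj => ?_
    have hj := Finset.mem_range.1 hj
    have hk : ((q (n + 1) - 1 + 1 + (q n - 1 - 1 - j) + 1 : ℕ) : ℝ)
        = q (n + 2) - ((j + 1 : ℕ) : ℝ) := by
      rw [eq_sub_iff_add_eq]
      exact_mod_cast (show q (n + 1) - 1 + 1 + (q n - 1 - 1 - j) + 1 + (j + 1) = q (n + 2) by omega)
    rw [hk, sub_mul, q_mul_conv, ← logKernel_neg (((j + 1 : ℕ) : ℝ) * _),
      ← logKernel_add_int (-(((j + 1 : ℕ) : ℝ) * _)) (p (n + 2))]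
    congr 1
    push_cast
    ring

/-- In `two_log_q_add_two` both partial sums are full-period sums, for `q (n + 1)` and `q n`,
perturbed to `conv (n + 2)`; the scaled perturbations tend to α and α². The logarithms of
denominators combine into ratios with limits. -/
lemma limitSum_add_limitSum :
    limitSum α univ + limitSum (α ^ 2) univ
      = -(2 * Real.log (2 * Real.pi * 1)) - 2 * Real.log α - 2 * Real.log (α ^ 2) := by
  have h1 := (tendsto_shift conv_succ_size (tendsto_conv_succ_size le_rfl) α_pos.le α_lt_one).comp
    (tendsto_add_atTop_nat 1)
  have h2 := tendsto_shift (fun n => (one_div_size_add_two_mem n).1) tendsto_size_add_two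
    (sq_nonneg α) (by nlinarith [α_pos, α_lt_one])
  have h3 := (tendsto_logKernel_div_q le_rfl one_pos (tendsto_const_nhds (x := (1 : ℝ)))).comp
    (tendsto_add_atTop_nat 2)
  have h4 := ((tendsto_q_div_q_succ.comp (tendsto_add_atTop_nat 1)).log α_pos.ne').const_mul 2
  have h5 := (tendsto_q_div_q_add_two.log (pow_pos α_pos 2).ne').const_mul 2
  refine tendsto_nhds_unique (h1.add h2) (((h3.neg.sub h4).sub h5).congr fun n => ?_)
  have hq := q_cast_ne n
  have hq1 := q_cast_ne (n + 1)
  have hq2 := q_cast_ne (n + 2)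
  have hsplit := two_log_q_add_two n
  simp only [Function.comp, shift]
  rw [← conv_succ, ← conv_add_two, birkhoff_conv, birkhoff_conv, Real.log_div hq1 hq2,
    Real.log_div hq hq2]
  linarith

/-- The last term k = `q n` lies close to the pole and is split off: its part -2 log `q n` cancels
the full rational sum 2 log `q n`. -/
lemma birkhoff_α_eq (n : ℕ) :
    birkhoff logKernel (q n) α = shift n (α ^ (n + 1) / q n)
      + (logKernel (α ^ (n + 1) * q n / q n) + 2 * Real.log (q n)) := by
  have hq := q_cast_ne n
  have hlast : logKernel (q n * α) = logKernel (α ^ (n + 1) * q n / q n) := by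
    have h := q_mul_α n
    rw [sub_eq_iff_eq_add, show (p n : ℝ) = ((p n : ℤ) : ℝ) by push_cast; rfl] at h
    rw [h, logKernel_add_int, logKernel_neg_one_pow_mul, mul_div_cancel_right₀ _ hq]
  have hs : birkhoff logKernel (q n) α = birkhoff logKernel (q n - 1) α + logKernel (q n * α) := by
    have h := Finset.sum_Icc_succ_top (show 1 ≤ q n - 1 + 1 by omega)
      (fun k : ℕ => logKernel (k * α))
    have hq1 : q n - 1 + 1 = q n := Nat.sub_add_cancel (q_pos n)
    rw [hq1] at h
    exact h
  rw [hs, hlast, shift, ← α_eq_conv_add, birkhoff_conv]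
  ring

/-- Let F(t) = `limitSum t univ`, s = 1/√5 and X = log(2πs) > 0, and suppose F(s) ≤ -2X. Since F(0)
= 0, concavity on 0 < s < α gives F(α) < 0. As α³ < s, the identity for F(α) + F(α²) makes that sum
exceed -2X. Inserting this into concavity on α² < s < α and using α + α² = 1 yields (1 - 2s)(-F(α))
< -2X(s - α²), whose left side is positive and right side negative. -/
lemma limit_pos : 0 < limitSum (1 / Real.sqrt 5) univ
    + 2 * Real.log (2 * Real.pi * (1 / Real.sqrt 5)) := by
  have h0 := half_lt_α
  have h1 := α_lt_two_thirds
  have h2 := α_sq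
  have hpi := Real.pi_gt_three
  set s : ℝ := 1 / Real.sqrt 5 with hs
  have hs5 : s * (2 * α + 1) = 1 := by
    rw [hs, sqrt_five_eq]; field_simp
  have hsα : s < α := by nlinarith
  have hs2 : α ^ 2 < s := by nlinarith
  have hs3 : α ^ 3 < s := by nlinarith
  have hs4 : 2 * s < 1 := by nlinarith
  have hs0 : 0 < s := by nlinarith
  have hsize0 : ∀ n, 0 ≤ α ^ (n + 1) / (q n : ℝ) := fun n =>
    div_nonneg (pow_pos α_pos _).le (q_cast_pos n).le
  have hfirst := limitSum_concave (d₁ := fun _ => 0) (fun _ => le_rfl) hsize0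
    (fun n => ⟨conv_succ_size n, le_rfl⟩) (t₁ := 0) (by simp) tendsto_size_α
    (tendsto_conv_succ_size le_rfl) le_rfl hs0 hsα α_lt_one
  have hsecond := limitSum_concave (fun n => (one_div_size_add_two_mem n).1) hsize0
    (fun n => ⟨conv_succ_size n, le_rfl⟩) tendsto_size_add_two tendsto_size_α
    (tendsto_conv_succ_size le_rfl) (sq_nonneg α) hs2 hsα α_lt_one
  have hzero : limitSum 0 univ = 0 := by simp [limitSum]
  have hsum := limitSum_add_limitSum
  rw [hzero, mul_zero, zero_add, sub_zero, sub_zero] at hfirst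
  have hX : 0 < Real.log (2 * Real.pi * s) := Real.log_pos (by nlinarith)
  have hlogα : 3 * Real.log α < Real.log s := by
    have := Real.log_lt_log (pow_pos α_pos 3) hs3
    rw [Real.log_pow] at this
    exact_mod_cast this
  rw [Real.log_pow, mul_one] at hsum
  push_cast at hsum
  have hXeq : Real.log (2 * Real.pi * s) = Real.log (2 * Real.pi) + Real.log s :=
    Real.log_mul (by positivity) hs0.ne'
  by_contra hcon
  push Not at hcon
  set a := limitSum α univ
  set b := limitSum (α ^ 2) univ
  set F := limitSum s univ
  set X := Real.log (2 * Real.pi * s)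
  have hF : F ≤ -(2 * X) := by linarith
  have ha : a < 0 := by
    by_contra h
    push Not at h
    nlinarith
  have hab : -(2 * X) < a + b := by linarith
  nlinarith [mul_lt_mul_of_pos_left hab (sub_pos.2 hsα), mul_le_mul_of_nonneg_left hF
    (show 0 ≤ α - α ^ 2 by nlinarith), mul_pos (show 0 < 1 - 2 * s by linarith) (neg_pos.2 ha),
    mul_pos (sub_pos.2 hs2) hX]

theorem tendsto_birkhoff_α :
    Tendsto (fun n => birkhoff logKernel (q n) α) atTop
      (𝓝 (limitSum (1 / Real.sqrt 5) univ + 2 * Real.log (2 * Real.pi * (1 / Real.sqrt 5)))) := by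
  have h5 : (0 : ℝ) < 1 / Real.sqrt 5 := by positivity
  have hlt : 1 / Real.sqrt 5 < 1 := by
    rw [sqrt_five_eq, div_lt_one (by linarith [α_pos])]
    linarith [α_pos]
  have h1 := tendsto_shift (fun n => div_nonneg (pow_pos α_pos (n + 1)).le (q_cast_pos n).le)
    tendsto_size_α h5.le hlt
  have h2 := tendsto_logKernel_div_q le_rfl h5 tendsto_α_pow_mul_q
  exact (h1.add h2).congr fun n => (birkhoff_α_eq n).symm

lemma two_le_q {n : ℕ} (hn : 2 ≤ n) : (2 : ℝ) ≤ q n := by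
  exact_mod_cast (show q 2 ≤ q n from q_mono hn)

lemma exists_log_birkhoff_α_bound : ∃ C : ℝ, ∀ n : ℕ, 2 ≤ n →
    |Real.log (birkhoff logKernel (q n) α) / Real.log (q n)| ≤ C := by
  have h := tendsto_birkhoff_α.log limit_pos.ne'
  obtain ⟨B, hB⟩ := h.norm.bddAbove_range
  refine ⟨B / Real.log 2, fun n hn => ?_⟩
  have hlog2 : 0 < Real.log 2 := Real.log_pos one_lt_two
  have hq : Real.log 2 ≤ Real.log (q n) := Real.log_le_log two_pos (two_le_q hn)
  have h1 : |Real.log (birkhoff logKernel (q n) α)| ≤ B := hB ⟨n, rfl⟩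
  rw [abs_div, abs_of_nonneg (hlog2.le.trans hq)]
  have h0 := abs_nonneg (Real.log (birkhoff logKernel (q n) α))
  have hB0 : 0 ≤ B := h0.trans h1
  gcongr

lemma tendsto_birkhoff_conv_div :
    Tendsto (fun n => birkhoff logKernel (q n - 1) (conv n) / (q n : ℝ)) atTop (𝓝 0) := by
  have h := (Real.isLittleO_log_id_atTop.tendsto_div_nhds_zero.comp tendsto_q).const_mul 2
  rw [mul_zero] at h
  refine h.congr fun n => ?_
  rw [birkhoff_conv]
  simp [mul_div_assoc]

lemma log_birkhoff_conv_bound {n : ℕ} (hn : 2 ≤ n) :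
    0 < birkhoff logKernel (q n - 1) (conv n) ∧
      |Real.log (birkhoff logKernel (q n - 1) (conv n)) / Real.log (q n)| ≤ 2 := by
  have hlog2 := Real.log_two_gt_d9
  have hq : Real.log 2 ≤ Real.log (q n) := Real.log_le_log two_pos (two_le_q hn)
  have hpos : 0 < Real.log (q n) := by linarith
  rw [birkhoff_conv]
  refine ⟨by positivity, ?_⟩
  -- Here 2 log 2 > 1 is used, which is why `q n` ≥ 2 suffices.
  have h1 : 0 ≤ Real.log (2 * Real.log (q n)) := Real.log_nonneg (by linarith)
  have h2 : Real.log (2 * Real.log (q n)) ≤ 2 * Real.log (q n) :=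
    Real.log_le_self (by positivity)
  rw [abs_of_nonneg (div_nonneg h1 hpos.le), div_le_iff₀ hpos]
  exact h2

/-! ### Even and odd indices -/

lemma map_even_le : map (fun n : ℕ => 2 * n) atTop ≤ atTop :=
  tendsto_id.const_mul_atTop' two_pos

lemma map_odd_le : map (fun n : ℕ => 2 * n + 1) atTop ≤ atTop :=
  (tendsto_add_atTop_nat 1).comp map_even_le

lemma map_even_parity : ∀ᶠ n in map (fun n : ℕ => 2 * n) atTop, (-1 : ℝ) ^ n = 1 :=
  Eventually.of_forall (f := atTop) fun n => by simp

lemma map_odd_parity : ∀ᶠ n in map (fun n : ℕ => 2 * n + 1) atTop, (-1 : ℝ) ^ n = -1 :=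
  Eventually.of_forall (f := atTop) fun n => by simp [pow_succ]

end GoldenBirkhoff

open GoldenBirkhoff in
theorem mainTheorem6 :
    -- the difference functions of the real kernel, and of the combined complex kernel
    (∃ fe fo : ℝ → ℝ,
      (∀ x ∈ Ico (0 : ℝ) 1,
        Tendsto (fun n : ℕ => diff logKernel (2 * n) x) atTop (𝓝 (fe x)) ∧
        Tendsto (fun n : ℕ => diff logKernel (2 * n + 1) x) atTop (𝓝 (fo x))) ∧
      (∀ x ∈ Ico (0 : ℝ) 1 \ orbitPoints,
        fe x = fo x ∧ Tendsto (fun n : ℕ => diff logKernel n x) atTop (𝓝 (fe x))) ∧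
      (∀ x ∈ Ico (0 : ℝ) 1,
        Tendsto (fun n : ℕ => diff complexKernel (2 * n) x) atTop
          (𝓝 ((fe x : ℂ) + ((c * x ^ 2 : ℝ) : ℂ) * Complex.I)) ∧
        Tendsto (fun n : ℕ => diff complexKernel (2 * n + 1) x) atTop
          (𝓝 ((fo x : ℂ) - ((c * x ^ 2 : ℝ) : ℂ) * Complex.I))) ∧
      MonotoneOn (fun x => fe (α * x) + α ^ 2 * fe x) (Ico (0 : ℝ) 1 \ orbitPoints) ∧
      MonotoneOn (fun x => fo (α * x) + α ^ 2 * fe x) (Ico (0 : ℝ) 1) ∧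
      MonotoneOn (fun x => fe (α * x) + α ^ 2 * fo x) (Ico (0 : ℝ) 1)) ∧
    -- the difference functions of the imaginary kernel
    (∀ x ∈ Ico (0 : ℝ) 1,
      Tendsto (fun n : ℕ => diff sawtooth (2 * n) x) atTop (𝓝 (c * x ^ 2)) ∧
      Tendsto (fun n : ℕ => diff sawtooth (2 * n + 1) x) atTop (𝓝 (-(c * x ^ 2)))) ∧
    -- the sums over `q n` steps of the golden rotation
    (∃ L : ℝ, 0 < L ∧
      Tendsto (fun n : ℕ => birkhoff logKernel (q n) α) atTop (𝓝 L)) ∧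
    (∃ C : ℝ, ∀ n : ℕ, 2 ≤ n →
      |Real.log (birkhoff logKernel (q n) α) / Real.log (q n)| ≤ C) ∧
    -- the Riemann sums on the grid of the multiples of `1 / q n`, the pole being left out
    Tendsto (fun n : ℕ => birkhoff logKernel (q n - 1) ((p n : ℝ) / (q n : ℝ)) / (q n : ℝ))
      atTop (𝓝 0) ∧
    (∃ C : ℝ, ∀ n : ℕ, 2 ≤ n →
      0 < birkhoff logKernel (q n - 1) ((p n : ℝ) / (q n : ℝ)) ∧
      |Real.log (birkhoff logKernel (q n - 1) ((p n : ℝ) / (q n : ℝ))) / Real.log (q n)| ≤ C) := by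
  refine ⟨⟨diffLimit 1, diffLimit (-1), fun x hx => ⟨?_, ?_⟩, fun x hx => ⟨?_, ?_⟩,
    fun x hx => ⟨?_, ?_⟩, ?_, ?_, ?_⟩, fun x hx => ⟨?_, ?_⟩, ⟨_, limit_pos, tendsto_birkhoff_α⟩,
    exists_log_birkhoff_α_bound, tendsto_birkhoff_conv_div, 2, fun n hn => log_birkhoff_conv_bound hn⟩
  · exact tendsto_map'_iff.1
      (tendsto_diff_logKernel map_even_le (Or.inl rfl) (Or.inr map_even_parity) hx)
  · exact tendsto_map'_iff.1
      (tendsto_diff_logKernel map_odd_le (Or.inr rfl) (Or.inr map_odd_parity) hx)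
  · rw [diffLimit, diffLimit, hitSet_congr hx.2 1 (-1)]
  · exact tendsto_diff_logKernel le_rfl (Or.inl rfl) (Or.inl hx.2) hx.1
  · have h := tendsto_map'_iff.1
      (tendsto_diff_complexKernel map_even_le (Or.inl rfl) map_even_parity hx)
    rwa [one_mul] at h
  · have h := tendsto_map'_iff.1
      (tendsto_diff_complexKernel map_odd_le (Or.inr rfl) map_odd_parity hx)
    rwa [neg_one_mul, Complex.ofReal_neg, neg_mul, ← sub_eq_add_neg] at h
  -- The odd parity combination already has the even limit at αx, so only its value at x, outside
  -- the exceptional orbit, has to be exchanged; αx itself may lie in that orbit.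
  · intro x hx y hy hxy
    have h := monotoneOn_diffLimit map_odd_le (Or.inr rfl) map_odd_parity hx.1 hy.1 hxy
    have heq : ∀ z ∉ orbitPoints, diffLimit (-1) z = diffLimit 1 z := fun z hz => by
      rw [diffLimit, diffLimit, hitSet_congr hz 1 (-1)]
    simpa only [neg_neg, heq x hx.2, heq y hy.2] using h
  · exact monotoneOn_diffLimit map_even_le (Or.inl rfl) map_even_parity
  · simpa only [neg_neg] using monotoneOn_diffLimit map_odd_le (Or.inr rfl) map_odd_parity
  · have h := tendsto_map'_iff.1 (tendsto_diff_sawtooth map_even_le map_even_parity hx)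
    rwa [one_mul] at h
  · have h := tendsto_map'_iff.1 (tendsto_diff_sawtooth map_odd_le map_odd_parity hx)
    rwa [neg_one_mul] at h
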